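/- All logarithms are to base $2$. Let $\mathbb X$ (alphabet) and $\mathbb S$ (states) be finite sets. A unifilar source $P$ consists of an initial state $s_0\in\mathbb S$, conditional PMFs $P(\cdot\mid s)$ on $\mathbb X$ for $s\in\mathbb S$, and a map $\phi:\mathbb X\times\mathbb S\to\mathbb S$ such that $x\mapsto\phi(x,s)$ is one-to-one for every $s$; the states are $s_i=\phi(x_i,s_{i-1})$, and strings have probability $P_n(x^n)=\prod_{i=1}^n P(x_i\mid s_{i-1})$. *Cipher system.* A message $X^n\sim P_n$ is encrypted with an independent key $U$, uniform on $\{0,1\}^{k_n}$, into a cryptogram $Y=f_n(X^n,U)$, a finite bit string, where $f_n(\cdot,u)$ is one-to-one for every $u$. The key rate is $R$: $k_n/n\to R$. The attacker, who sees $Y=y$, guesses the messages in decreasing order of $P_{X^n\mid Y}(\cdot\mid y)$; $G_{f_n}(x^n\mid y)$ is the number of guesses up to and including $x^n$. For $B\in\mathbb R$ put $$F_n(R,B)=\inf_{f_n}\Big[-\tfrac1n\log P_n\{G_{f_n}(X^n\mid Y)\ge 2^{nB}\}\Big]\in[0,\infty].$$ *Error exponent.* Let $Q$ range over the PMFs on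 $\mathbb S\times\mathbb X$ that are stationary for $\phi$, i.e. $\sum_{(s,x):\phi(x,s)=t}Q(s,x)=Q(t)$ for all $t\in\mathbb S$, where $Q(t)=\sum_x Q(t,x)$. With $q(x\mid s)=Q(s,x)/Q(s)$ put $$H(Q)=-\sum_{s,x}Q(s,x)\log q(x\mid s),\qquad D(Q\|P)=\sum_{s,x}Q(s,x)\log\frac{q(x\mid s)}{P(x\mid s)}\in[0,\infty],$$ $$F(B)=\min_{Q:\,H(Q)\ge B}D(Q\|P),$$ which is $\infty$ if no such $Q$ exists. **Corollary.** (i) If $B>R$, then $\lim_{n\to\infty}F_n(R,B)=\infty$. (ii) Assume that the Markov chain of the states is irreducible and that $B\ne\max\{H(Q):D(Q\|P)<\infty\}$ (this maximum is $\log|\mathbb X|$ if all $P(x\mid s)$ are positive). If $B<R$, then $\lim_{n\to\infty}F_n(R,B)=F(B)$. Moreover, whatever $R$ is, $F(B)$ is the source-coding error exponent of $P$: $$\lim_{n\to\infty}\ \sup_{L_n}\Big[-\tfrac1n\log P_n\{L_n(X^n)\ge nB\}\Big]=F(B),$$ where $L_n:\mathbb X^n\to\{0,1,2,\dots\}$ ranges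 over the functions with $\sum_{x^n}2^{-L_n(x^n)}\le1$. (iii) If $B\le\log|\mathbb X|$, then the minimum that defines $F(B)$ is attained. -/

import Mathlib

open Filter Topology

noncomputable section

/-- A unifilar source with finite alphabet `X` and finite state set `S`: from state `s` the letter
`x` is emitted with probability `prob s x = P(x | s)`, and the state then becomes `next x s`. -/
structure UnifilarSource (X S : Type*) [Fintype X] where
  next : X → S → S
  next_injective : ∀ s, Function.Injective fun x => next x s
  prob : S → X → ℝ
  prob_nonneg : ∀ s x, 0 ≤ prob s x
  prob_sum : ∀ s, ∑ x, prob s x = 1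
  init : S

/-- An encryption function with `k` key bits: the message `x` and the key `u` are mapped to a
cryptogram, a bit string of variable length, and the message can be recovered from the cryptogram
and the key. -/
structure Encryption (M : Type*) (k : ℕ) where
  enc : M → (Fin k → Bool) → List Bool
  enc_injective : ∀ u, Function.Injective fun x => enc x u

section Guessing

variable {M : Type*} [Fintype M] {k : ℕ}

/-- The probability that the message is `x` and the cryptogram is `y`, for a message of law `p` and
an independent key that is uniform on `k` bits. -/
def jointProb (p : M → ℝ) (f : Encryption M k) (x : M) (y : List Bool) : ℝ :=
  ∑ u : Fin k → Bool, if f.enc x u = y then p x / 2 ^ k else 0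

/-- The posterior probability of the message `x` given the cryptogram `y`. -/
def posterior (p : M → ℝ) (f : Encryption M k) (y : List Bool) (x : M) : ℝ :=
  jointProb p f x y / ∑ x', jointProb p f x' y

/-- Some order of the messages lists them by decreasing posterior probability. -/
theorem exists_optimalOrder (p : M → ℝ) (f : Encryption M k) (y : List Bool) :
    ∃ e : M ≃ Fin (Fintype.card M), Antitone fun i => posterior p f y (e.symm i) := by
  let e₀ := Fintype.equivFin M
  let g : Fin (Fintype.card M) → ℝ := fun i => -posterior p f y (e₀.symm i)
  refine ⟨e₀.trans (Tuple.sort g).symm, fun i j hij => ?_⟩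
  have h := Tuple.monotone_sort g hij
  simpa [g] using h

/-- The optimal attack `G_f`: having seen `y`, guess the messages by decreasing posterior
probability (with some rule for ties); `optimalGuess p f x y` is the number of guesses up to and
including the message `x`. -/
def optimalGuess (p : M → ℝ) (f : Encryption M k) (x : M) (y : List Bool) : ℕ :=
  (exists_optimalOrder p f y).choose x + 1

/-- The probability that the optimal attack needs at least `t` guesses. -/
def guessTail (p : M → ℝ) (f : Encryption M k) (t : ℝ) : ℝ :=
  ∑ x, ∑ u : Fin k → Bool,
    if t ≤ (optimalGuess p f x (f.enc x u) : ℝ) then p x / 2 ^ k else 0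

/-- Length functions: those that satisfy Kraft's inequality. -/
def IsLengthFunction (L : M → ℕ) : Prop :=
  ∑ x, (2 : ℝ)⁻¹ ^ L x ≤ 1

/-- The probability that the length is at least `t`. -/
def lengthTail (p : M → ℝ) (L : M → ℕ) (t : ℝ) : ℝ :=
  ∑ x, if t ≤ (L x : ℝ) then p x else 0

end Guessing

/-- `-(1/n) log q` with the logarithm to base 2 and with value `∞` at `q = 0`. -/
def negLogRate (n : ℕ) (q : ℝ) : EReal :=
  if q = 0 then ⊤ else ((-(1 / (n : ℝ)) * Real.logb 2 q : ℝ) : EReal)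

section PMF

variable {X S : Type*} [Fintype X]

/-- The state marginal `Q(s)`. -/
def stateMarginal (Q : S → X → ℝ) (s : S) : ℝ := ∑ x, Q s x

/-- The letter probability `q(x | s)` given the state, which is `0` where `Q(s) = 0`. -/
def condLetter (Q : S → X → ℝ) (s : S) (x : X) : ℝ := Q s x / stateMarginal Q s

/-- The conditional entropy `H(Q)` of the letter given the state, in bits. -/
def condEntropy [Fintype S] (Q : S → X → ℝ) : ℝ :=
  -∑ s, ∑ x, Q s x * Real.logb 2 (condLetter Q s x)

end PMF

namespace UnifilarSource

variable {X S : Type*} [Fintype X]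

/-- The state `s_i` reached from the initial state after the first `i` letters of `x`. -/
def state (P : UnifilarSource X S) {n : ℕ} (x : Fin n → X) (i : ℕ) : S :=
  ((List.ofFn x).take i).foldl (fun s a => P.next a s) P.init

/-- The probability `P_n(x^n)` of a string. -/
def strProb (P : UnifilarSource X S) (n : ℕ) (x : Fin n → X) : ℝ :=
  ∏ i : Fin n, P.prob (P.state x i) (x i)

/-- Irreducibility of the Markov chain of the states. -/
def Irreducible (P : UnifilarSource X S) : Prop :=
  ∀ s t, Relation.ReflTransGen (fun a b => ∃ x, 0 < P.prob a x ∧ P.next x a = b) s t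

/-- `F_n(R, B)` with `k = nR` key bits. -/
def guessExponent (P : UnifilarSource X S) (n k : ℕ) (B : ℝ) : EReal :=
  ⨅ f : Encryption (Fin n → X) k, negLogRate n (guessTail (P.strProb n) f (2 ^ ((n : ℝ) * B)))

/-- The best exponent of the probability that the codeword length is at least `n B`, over all
length functions on strings of length `n`. -/
def codeExponent (P : UnifilarSource X S) (n : ℕ) (B : ℝ) : EReal :=
  ⨆ L : {L : (Fin n → X) → ℕ // IsLengthFunction L},
    negLogRate n (lengthTail (P.strProb n) L.1 ((n : ℝ) * B))

variable [Fintype S]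

open scoped Classical in
/-- `Q` is a joint PMF of state and letter for which the state after the letter has the same law as
the state before it, that is, `Q` is the one-step law of a stationary unifilar source with the
same next-state function. -/
structure IsStationaryPMF (P : UnifilarSource X S) (Q : S → X → ℝ) : Prop where
  nonneg : ∀ s x, 0 ≤ Q s x
  sum_eq_one : ∑ s, ∑ x, Q s x = 1
  stationary : ∀ t, (∑ s, ∑ x, if P.next x s = t then Q s x else 0) = stateMarginal Q t

/-- `Q` charges only transitions that have positive probability under `P`. -/
def AbsCont (P : UnifilarSource X S) (Q : S → X → ℝ) : Prop :=
  ∀ s x, P.prob s x = 0 → Q s x = 0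

open scoped Classical in
/-- The conditional Kullback–Leibler divergence `D(Q ‖ P)` in bits. -/
def condDiv (P : UnifilarSource X S) (Q : S → X → ℝ) : EReal :=
  if P.AbsCont Q then
    ((∑ s, ∑ x, Q s x * Real.logb 2 (condLetter Q s x / P.prob s x) : ℝ) : EReal)
  else ⊤

/-- The values `D(Q ‖ P)` over the stationary `Q` with `H(Q) ≥ B`. -/
def feasibleDivs (P : UnifilarSource X S) (B : ℝ) : Set EReal :=
  {d | ∃ Q, P.IsStationaryPMF Q ∧ B ≤ condEntropy Q ∧ P.condDiv Q = d}

/-- `F(B) = min {D(Q ‖ P) : H(Q) ≥ B}`, with value `∞` if there is no such `Q`. -/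
def errorExponent (P : UnifilarSource X S) (B : ℝ) : EReal := sInf (P.feasibleDivs B)

/-- The values `H(Q)` over the stationary `Q` with `D(Q ‖ P) < ∞`. -/
def attainableEntropies (P : UnifilarSource X S) : Set ℝ :=
  {h | ∃ Q, P.IsStationaryPMF Q ∧ P.condDiv Q < ⊤ ∧ condEntropy Q = h}

end UnifilarSource

end

/-! The proof is the method of types. The empirical law `Q` of state and letter along a string of
length `n` is stationary up to `1 / n`. At most `2 ^ (n H(Q))` strings share it, their total
probability is at most `2 ^ (-n D(Q ‖ P))`, and the number of types is polynomial in `n`.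
Compactness replaces nearly stationary laws by stationary ones (`exists_gap`). So the strings of
empirical entropy below `B - δ` number less than `2 ^ (n B)`, and the others have probability at
most `2 ^ (-n c)` for any `c < F(B)` (`exists_small_set`). An attacker who ignores the cryptogram
and guesses the former first, or a code that gives them short words, achieves the exponent `c`.

For the opposite bounds, a change of measure replaces the exact counting of strings of a type. As
`B` is not the largest attainable entropy, concavity provides a `Q` of full support with `H(Q) > B`
and `D(Q ‖ P)` close to `F(B)` (`exists_good_law`). The source tilted to `Q` is irreducible with
unique stationary law `Q`, so the large-deviation bound, applied to it, is a law of large numbers.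
Its typical strings number about `2 ^ (n H(Q))` and have `P`-probability about `2 ^ (-n (H(Q) + D(Q
‖ P)))` each (`exists_large_set`). Cut them into blocks slightly larger than `2 ^ (n B)` and apply a
one-time pad to the position within the block: this hides a fixed fraction of their mass. Kraft's
inequality makes most of their codewords long.

If `B > R`, a cryptogram is compatible with at most `2 ^ k < 2 ^ (n B)` messages, one per key. The
minimum is attained by compactness; where all divergences are infinite, a law of entropy at least
`log |X|` shows that the feasible set is nonempty. -/

noncomputable section

/-! ### Joint laws and continuity of the conditional entropy -/

section PMFs

variable {X S : Type*} [Fintype X]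

theorem stateMarginal_nonneg {Q : S → X → ℝ} (hQ : ∀ s x, 0 ≤ Q s x) (s : S) :
    0 ≤ stateMarginal Q s :=
  Finset.sum_nonneg fun x _ => hQ s x

theorem le_stateMarginal {Q : S → X → ℝ} (hQ : ∀ s x, 0 ≤ Q s x) (s : S) (x : X) :
    Q s x ≤ stateMarginal Q s :=
  Finset.single_le_sum (f := fun x => Q s x) (fun x _ => hQ s x) (Finset.mem_univ x)

theorem eq_zero_of_stateMarginal_eq_zero {Q : S → X → ℝ} (hQ : ∀ s x, 0 ≤ Q s x) {s : S}
    (h : stateMarginal Q s = 0) (x : X) : Q s x = 0 :=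
  le_antisymm (h ▸ le_stateMarginal hQ s x) (hQ s x)

variable [Fintype S]

/-- The joint PMFs of a state and a letter. -/
def jointPMFs (S X : Type*) [Fintype X] [Fintype S] : Set (S → X → ℝ) :=
  {Q | (∀ s x, 0 ≤ Q s x) ∧ ∑ s, ∑ x, Q s x = 1}

theorem isCompact_jointPMFs : IsCompact (jointPMFs S X) := by
  have hclosed : IsClosed (jointPMFs S X) := by
    have h : jointPMFs S X =
        (⋂ s, ⋂ x, {Q : S → X → ℝ | 0 ≤ Q s x}) ∩ {Q | ∑ s, ∑ x, Q s x = 1} := by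
      ext Q; simp [jointPMFs]
    rw [h]
    refine IsClosed.inter (isClosed_iInter fun s => isClosed_iInter fun x => ?_) ?_
    · exact isClosed_le continuous_const (by fun_prop)
    · exact isClosed_eq (by fun_prop) continuous_const
  refine (isCompact_Icc (a := (0 : S → X → ℝ)) (b := 1)).of_isClosed_subset hclosed ?_
  rintro Q ⟨h0, h1⟩
  refine ⟨fun s x => h0 s x, fun s x => ?_⟩
  calc Q s x ≤ stateMarginal Q s := le_stateMarginal h0 s x
    _ ≤ ∑ s, stateMarginal Q s :=
      Finset.single_le_sum (f := fun s => stateMarginal Q s)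
        (fun s _ => stateMarginal_nonneg h0 s) (Finset.mem_univ s)
    _ = 1 := h1

/-- The chain rule removes the quotient `Q(s, x) / Q(s)`, which is discontinuous at `Q(s) = 0`, in
favour of the continuous function `negMulLog`. -/
theorem condEntropy_eq_negMulLog {Q : S → X → ℝ} (hQ : ∀ s x, 0 ≤ Q s x) :
    condEntropy Q = (∑ s, ∑ x, Real.negMulLog (Q s x)
      - ∑ s, Real.negMulLog (stateMarginal Q s)) / Real.log 2 := by
  unfold condEntropy
  rw [← Finset.sum_sub_distrib, Finset.sum_div, ← Finset.sum_neg_distrib]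
  refine Finset.sum_congr rfl fun s _ => ?_
  have h1 : Real.negMulLog (stateMarginal Q s)
      = ∑ x, - (Q s x * Real.log (stateMarginal Q s)) := by
    rw [Finset.sum_neg_distrib, ← Finset.sum_mul, Real.negMulLog, neg_mul]; rfl
  rw [h1, ← Finset.sum_sub_distrib, Finset.sum_div, ← Finset.sum_neg_distrib]
  refine Finset.sum_congr rfl fun x _ => ?_
  unfold condLetter Real.logb Real.negMulLog
  rcases eq_or_ne (Q s x) 0 with h | h
  · simp [h]
  · have : stateMarginal Q s ≠ 0 := fun h' => h (eq_zero_of_stateMarginal_eq_zero hQ h' x)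
    rw [Real.log_div h this]
    ring

theorem continuousOn_condEntropy :
    ContinuousOn (condEntropy : (S → X → ℝ) → ℝ) {Q | ∀ s x, 0 ≤ Q s x} := by
  refine ContinuousOn.congr (f := fun Q : S → X → ℝ => (∑ s, ∑ x, Real.negMulLog (Q s x)
      - ∑ s, Real.negMulLog (stateMarginal Q s)) / Real.log 2) ?_
    fun Q hQ => condEntropy_eq_negMulLog hQ
  unfold stateMarginal
  refine Continuous.continuousOn ?_
  refine Continuous.div_const (Continuous.sub ?_ ?_) _
  · refine continuous_finsetSum _ fun s _ => continuous_finsetSum _ fun x _ => ?_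
    exact Real.continuous_negMulLog.comp (by fun_prop)
  · refine continuous_finsetSum _ fun s _ => ?_
    exact Real.continuous_negMulLog.comp (by fun_prop)

end PMFs

/-! ### Divergence, Gibbs' inequality and tilted sources -/

namespace UnifilarSource

variable {X S : Type*} [Fintype X] [Fintype S]

/-- The mean of `log P(x | s)` under `Q`. -/
def meanLog (P : UnifilarSource X S) (Q : S → X → ℝ) : ℝ :=
  ∑ s, ∑ x, Q s x * Real.logb 2 (P.prob s x)

/-- The real number that is `D(Q ‖ P)` where the latter is finite. -/
def realDiv (P : UnifilarSource X S) (Q : S → X → ℝ) : ℝ := -condEntropy Q - P.meanLog Q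

theorem continuous_meanLog (P : UnifilarSource X S) : Continuous P.meanLog := by
  unfold meanLog; fun_prop

theorem continuousOn_realDiv (P : UnifilarSource X S) :
    ContinuousOn P.realDiv {Q | ∀ s x, 0 ≤ Q s x} :=
  (continuousOn_condEntropy.neg).sub P.continuous_meanLog.continuousOn

theorem realDiv_eq_sum (P : UnifilarSource X S) {Q : S → X → ℝ} (hQ : ∀ s x, 0 ≤ Q s x)
    (hac : P.AbsCont Q) :
    P.realDiv Q = ∑ s, ∑ x, Q s x * Real.logb 2 (condLetter Q s x / P.prob s x) := by
  unfold realDiv condEntropy meanLog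
  rw [neg_neg, ← Finset.sum_sub_distrib]
  refine Finset.sum_congr rfl fun s _ => ?_
  rw [← Finset.sum_sub_distrib]
  refine Finset.sum_congr rfl fun x _ => ?_
  rcases eq_or_ne (Q s x) 0 with h | h
  · simp [h]
  · have h1 : stateMarginal Q s ≠ 0 := fun h' => h (eq_zero_of_stateMarginal_eq_zero hQ h' x)
    have h2 : P.prob s x ≠ 0 := fun h' => h (hac s x h')
    rw [condLetter, Real.logb_div (div_ne_zero h h1) h2]
    ring

theorem condDiv_of_absCont (P : UnifilarSource X S) {Q : S → X → ℝ} (hQ : ∀ s x, 0 ≤ Q s x)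
    (hac : P.AbsCont Q) : P.condDiv Q = (P.realDiv Q : EReal) := by
  rw [condDiv, if_pos hac, P.realDiv_eq_sum hQ hac]

theorem absCont_of_condDiv_lt_top (P : UnifilarSource X S) {Q : S → X → ℝ}
    (h : P.condDiv Q < ⊤) : P.AbsCont Q := by
  by_contra h'
  simp [condDiv, h'] at h

/-- **Gibbs' inequality**, termwise. -/
theorem sub_le_mul_log_div {q m p : ℝ} (hq : 0 ≤ q) (hm : 0 ≤ m) (hp : 0 ≤ p)
    (hqm : m = 0 → q = 0) (hqp : p = 0 → q = 0) :
    q - m * p ≤ q * Real.log (q / m / p) ∧ (q - m * p = q * Real.log (q / m / p) → q = m * p) := by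
  rcases hq.eq_or_lt with h | h
  · subst h
    have := mul_nonneg hm hp
    simp only [zero_sub, zero_mul]
    exact ⟨by linarith, fun h => by linarith⟩
  · have hm' : 0 < m := hm.lt_of_ne fun h' => h.ne' (hqm h'.symm)
    have hp' : 0 < p := hp.lt_of_ne fun h' => h.ne' (hqp h'.symm)
    -- With `r = m p / q` the claim is `log r ≤ r - 1`, which is strict unless `r = 1`.
    have h1 : q / m / p = (m * p / q)⁻¹ := by field_simp
    have hr : 0 < m * p / q := by positivity
    have h2 : q - m * p = q * (1 - m * p / q) := by field_simp
    rw [h1, h2, Real.log_inv]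
    refine ⟨mul_le_mul_of_nonneg_left ?_ h.le, fun h3 => ?_⟩
    · linarith [Real.log_le_sub_one_of_pos hr]
    · by_contra h4
      have h5 : m * p / q ≠ 1 := fun h6 => h4 (by field_simp at h6; linarith)
      have := Real.log_lt_sub_one_of_pos hr h5
      have := mul_left_cancel₀ h.ne' h3
      linarith

theorem log_two_mul_realDiv (P : UnifilarSource X S) {Q : S → X → ℝ} (hQ : ∀ s x, 0 ≤ Q s x)
    (hac : P.AbsCont Q) : Real.log 2 * P.realDiv Q =
      ∑ s, ∑ x, Q s x * Real.log (Q s x / stateMarginal Q s / P.prob s x) := by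
  rw [P.realDiv_eq_sum hQ hac, Finset.mul_sum]
  refine Finset.sum_congr rfl fun s _ => ?_
  rw [Finset.mul_sum]
  refine Finset.sum_congr rfl fun x _ => ?_
  have : Real.log 2 ≠ 0 := (Real.log_pos one_lt_two).ne'
  rw [Real.logb, condLetter]
  field_simp

theorem sum_sub_marginal_mul_prob (P : UnifilarSource X S) (Q : S → X → ℝ) :
    ∑ s, ∑ x, (Q s x - stateMarginal Q s * P.prob s x) = 0 := by
  refine Finset.sum_eq_zero fun s _ => ?_
  rw [Finset.sum_sub_distrib, ← Finset.mul_sum, P.prob_sum, mul_one]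
  exact sub_self _

theorem realDiv_nonneg (P : UnifilarSource X S) {Q : S → X → ℝ} (hQ : ∀ s x, 0 ≤ Q s x)
    (hac : P.AbsCont Q) : 0 ≤ P.realDiv Q := by
  have h : 0 ≤ Real.log 2 * P.realDiv Q := by
    rw [P.log_two_mul_realDiv hQ hac, ← P.sum_sub_marginal_mul_prob Q]
    refine Finset.sum_le_sum fun s _ => Finset.sum_le_sum fun x _ => ?_
    exact (sub_le_mul_log_div (hQ s x) (stateMarginal_nonneg hQ s) (P.prob_nonneg s x)
      (fun h => eq_zero_of_stateMarginal_eq_zero hQ h x) (hac s x)).1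
  exact nonneg_of_mul_nonneg_right h (Real.log_pos one_lt_two)

/-- The equality case of Gibbs' inequality: a law of zero divergence has the letter probabilities of
`P` in every state it charges. -/
theorem eq_marginal_mul_prob_of_realDiv_nonpos (P : UnifilarSource X S) {Q : S → X → ℝ}
    (hQ : ∀ s x, 0 ≤ Q s x) (hac : P.AbsCont Q) (h : P.realDiv Q ≤ 0) (s : S) (x : X) :
    Q s x = stateMarginal Q s * P.prob s x := by
  have h0 : P.realDiv Q = 0 := le_antisymm h (P.realDiv_nonneg hQ hac)
  have key := fun s x => sub_le_mul_log_div (hQ s x) (stateMarginal_nonneg hQ s)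
    (P.prob_nonneg s x) (fun h => eq_zero_of_stateMarginal_eq_zero hQ h x) (hac s x)
  have h1 := P.log_two_mul_realDiv hQ hac
  rw [h0, mul_zero, ← P.sum_sub_marginal_mul_prob Q,
    Finset.sum_eq_sum_iff_of_le fun s _ => Finset.sum_le_sum fun x _ => (key s x).1] at h1
  have h2 := h1 s (Finset.mem_univ s)
  rw [Finset.sum_eq_sum_iff_of_le fun x _ => (key s x).1] at h2
  exact (key s x).2 (h2 x (Finset.mem_univ x))

/-- The source with the next-state function of `P` and the conditional letter probabilities of
`Q` (those of `P` in the states that `Q` does not charge). -/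
def tilt (P : UnifilarSource X S) (Q : S → X → ℝ) (hQ : ∀ s x, 0 ≤ Q s x) :
    UnifilarSource X S where
  next := P.next
  next_injective := P.next_injective
  prob s x := open scoped Classical in
    if stateMarginal Q s = 0 then P.prob s x else condLetter Q s x
  prob_nonneg s x := by
    split_ifs
    · exact P.prob_nonneg s x
    · exact div_nonneg (hQ s x) (stateMarginal_nonneg hQ s)
  prob_sum s := by
    split_ifs with h
    · exact P.prob_sum s
    · unfold condLetter
      rw [← Finset.sum_div]
      exact div_self h
  init := P.init

omit [Fintype S] in
theorem tilt_absCont (P : UnifilarSource X S) {Q : S → X → ℝ} (hQ : ∀ s x, 0 ≤ Q s x) :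
    (P.tilt Q hQ).AbsCont Q := by
  intro s x h
  by_cases h' : stateMarginal Q s = 0
  · exact eq_zero_of_stateMarginal_eq_zero hQ h' x
  · simpa [tilt, h', condLetter] using h

/-- This writes the entropy at `Q` as a functional linear in the law, the tilted source being fixed;
counting of types and concavity of entropy both rest on it. -/
theorem meanLog_tilt (P : UnifilarSource X S) {Q : S → X → ℝ} (hQ : ∀ s x, 0 ≤ Q s x) :
    (P.tilt Q hQ).meanLog Q = -condEntropy Q := by
  unfold meanLog condEntropy
  rw [neg_neg]
  refine Finset.sum_congr rfl fun s _ => Finset.sum_congr rfl fun x _ => ?_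
  by_cases h' : stateMarginal Q s = 0
  · simp [eq_zero_of_stateMarginal_eq_zero hQ h' x]
  · simp [tilt, h']

/-- Entropy is at most cross-entropy. -/
theorem condEntropy_le_neg_meanLog (P : UnifilarSource X S) {Q : S → X → ℝ}
    (hQ : ∀ s x, 0 ≤ Q s x) (hac : P.AbsCont Q) : condEntropy Q ≤ -P.meanLog Q := by
  have := P.realDiv_nonneg hQ hac
  unfold realDiv at this
  linarith

end UnifilarSource

/-! ### Strings, empirical laws and type classes -/

namespace UnifilarSource

section Strings

variable {X S : Type*} [Fintype X]

theorem state_succ (P : UnifilarSource X S) {n : ℕ} (x : Fin n → X) (i : Fin n) :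
    P.state x (i + 1) = P.next (x i) (P.state x i) := by
  unfold state
  rw [List.take_succ_eq_append_getElem (by simp), List.foldl_append]
  simp

theorem state_snoc (P : UnifilarSource X S) {n : ℕ} (x : Fin n → X) (a : X) {i : ℕ} (hi : i ≤ n) :
    P.state (Fin.snoc x a : Fin (n + 1) → X) i = P.state x i := by
  unfold state
  congr 1
  rw [List.ofFn_succ']
  simp only [Fin.snoc_castSucc, Fin.snoc_last, List.concat_eq_append]
  rw [List.take_append_of_le_length (by simpa using hi)]

theorem strProb_nonneg (P : UnifilarSource X S) {n : ℕ} (x : Fin n → X) : 0 ≤ P.strProb n x :=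
  Finset.prod_nonneg fun _ _ => P.prob_nonneg _ _

theorem strProb_snoc (P : UnifilarSource X S) {n : ℕ} (x : Fin n → X) (a : X) :
    P.strProb (n + 1) (Fin.snoc x a) = P.strProb n x * P.prob (P.state x n) a := by
  unfold strProb
  rw [Fin.prod_univ_castSucc]
  congr 1
  · refine Finset.prod_congr rfl fun i _ => ?_
    rw [Fin.snoc_castSucc, Fin.val_castSucc, P.state_snoc x a i.2.le]
  · rw [Fin.snoc_last, Fin.val_last, P.state_snoc x a le_rfl]

theorem sum_strProb (P : UnifilarSource X S) (n : ℕ) : ∑ x, P.strProb n x = 1 := by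
  induction n with
  | zero => simp [strProb]
  | succ n ih =>
    rw [← (Fin.snocEquiv fun _ : Fin (n + 1) => X).sum_comp, Fintype.sum_prod_type_right]
    rw [← ih]
    refine Finset.sum_congr rfl fun x _ => ?_
    have h : ∀ a, P.strProb (n + 1) ((Fin.snocEquiv fun _ : Fin (n + 1) => X) (a, x))
        = P.strProb n x * P.prob (P.state x n) a := fun a => P.strProb_snoc x a
    simp only [h]
    rw [← Finset.mul_sum, P.prob_sum, mul_one]

open scoped Classical in
/-- The number of times that the string `x` has the letter `a` emitted from the state `s`. -/
def count (P : UnifilarSource X S) {n : ℕ} (x : Fin n → X) (s : S) (a : X) : ℕ :=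
  (Finset.univ.filter fun i : Fin n => P.state x i = s ∧ x i = a).card

/-- The empirical law of state and letter along the string `x`. -/
def emp (P : UnifilarSource X S) {n : ℕ} (x : Fin n → X) (s : S) (a : X) : ℝ :=
  P.count x s a / n

theorem count_le (P : UnifilarSource X S) {n : ℕ} (x : Fin n → X) (s : S) (a : X) :
    P.count x s a ≤ n :=
  by classical exact (Finset.card_filter_le _ _).trans (by simp)

theorem emp_nonneg (P : UnifilarSource X S) {n : ℕ} (x : Fin n → X) (s : S) (a : X) :
    0 ≤ P.emp x s a := by unfold emp; positivity

variable [Fintype S]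

open scoped Classical in
theorem sum_along (P : UnifilarSource X S) {n : ℕ} (x : Fin n → X) (g : S → X → ℝ) :
    ∑ i : Fin n, g (P.state x i) (x i) = ∑ s, ∑ a, P.count x s a * g s a := by
  have h : ∀ i : Fin n, g (P.state x i) (x i)
      = ∑ s, ∑ a, if P.state x i = s ∧ x i = a then g s a else 0 := by
    intro i
    simp only [ite_and]
    simp
  simp_rw [h]
  rw [Finset.sum_comm]
  refine Finset.sum_congr rfl fun s _ => ?_
  rw [Finset.sum_comm]
  refine Finset.sum_congr rfl fun a _ => ?_
  rw [← Finset.sum_filter, Finset.sum_const, nsmul_eq_mul]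
  rfl

theorem sum_along_eq_emp (P : UnifilarSource X S) {n : ℕ} (x : Fin n → X) (g : S → X → ℝ) :
    ∑ i : Fin n, g (P.state x i) (x i) = n * ∑ s, ∑ a, P.emp x s a * g s a := by
  rcases Nat.eq_zero_or_pos n with rfl | hn
  · simp
  · rw [sum_along, Finset.mul_sum]
    refine Finset.sum_congr rfl fun s _ => ?_
    rw [Finset.mul_sum]
    refine Finset.sum_congr rfl fun a _ => ?_
    unfold emp
    field_simp

theorem emp_mem_jointPMFs (P : UnifilarSource X S) {n : ℕ} (hn : 0 < n) (x : Fin n → X) :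
    P.emp x ∈ jointPMFs S X := by
  refine ⟨P.emp_nonneg x, ?_⟩
  have h := P.sum_along_eq_emp x fun _ _ => 1
  simp only [mul_one, Finset.sum_const, Finset.card_univ, Fintype.card_fin, nsmul_eq_mul] at h
  have : (n : ℝ) ≠ 0 := by positivity
  field_simp at h
  exact h.symm

open scoped Classical in
/-- The net flow into the state `t`. -/
def netFlow (P : UnifilarSource X S) (Q : S → X → ℝ) (t : S) : ℝ :=
  (∑ s, ∑ x, if P.next x s = t then Q s x else 0) - stateMarginal Q t

theorem continuous_netFlow (P : UnifilarSource X S) (t : S) :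
    Continuous fun Q => P.netFlow Q t := by
  classical
  unfold netFlow stateMarginal
  refine Continuous.sub ?_ (by fun_prop)
  refine continuous_finsetSum _ fun s _ => continuous_finsetSum _ fun x _ => ?_
  split_ifs <;> fun_prop

theorem isStationaryPMF_iff (P : UnifilarSource X S) (Q : S → X → ℝ) :
    P.IsStationaryPMF Q ↔ Q ∈ jointPMFs S X ∧ ∀ t, P.netFlow Q t = 0 := by
  constructor
  · intro h
    exact ⟨⟨h.nonneg, h.sum_eq_one⟩, fun t => sub_eq_zero.2 (h.stationary t)⟩
  · rintro ⟨⟨h1, h2⟩, h3⟩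
    exact ⟨h1, h2, fun t => sub_eq_zero.1 (h3 t)⟩

/-- Arrivals at `t` minus departures from `t` telescope along the path, so only the first and the
last state contribute. -/
theorem abs_netFlow_emp_le (P : UnifilarSource X S) {n : ℕ} (x : Fin n → X) (t : S) :
    |P.netFlow (P.emp x) t| ≤ 1 / n := by
  classical
  rcases Nat.eq_zero_or_pos n with rfl | hn
  · simp [netFlow, emp, stateMarginal]
  have h1 := P.sum_along_eq_emp x fun s a => if P.next a s = t then 1 else 0
  have h2 := P.sum_along_eq_emp x fun s _ => if s = t then 1 else 0
  have h3 : ∑ i : Fin n, ((if P.next (x i) (P.state x i) = t then (1 : ℝ) else 0)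
      - if P.state x i = t then 1 else 0)
      = (if P.state x n = t then 1 else 0) - if P.state x 0 = t then 1 else 0 := by
    rw [← Finset.sum_range_sub (fun i => if P.state x i = t then (1 : ℝ) else 0) n,
      ← Fin.sum_univ_eq_sum_range
        (fun i => (if P.state x (i + 1) = t then (1 : ℝ) else 0) - if P.state x i = t then 1 else 0)]
    simp only [P.state_succ]
  rw [Finset.sum_sub_distrib, h1, h2, ← mul_sub] at h3
  have h4 : P.netFlow (P.emp x) t = ∑ s, ∑ a, P.emp x s a * (if P.next a s = t then 1 else 0)
      - ∑ s, ∑ a, P.emp x s a * (if s = t then 1 else 0) := by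
    unfold netFlow stateMarginal
    congr 1
    · simp
    · simp only [← Finset.sum_mul]; simp
  rw [← h4] at h3
  have hn' : (0 : ℝ) < n := by positivity
  rw [le_div_iff₀ hn', ← abs_of_pos hn', ← abs_mul, mul_comm, h3]
  split_ifs <;> simp

/-- Absolute continuity excludes zero factors, whose logarithm would take the default value `0`. -/
theorem strProb_eq_rpow (P : UnifilarSource X S) {n : ℕ} (x : Fin n → X)
    (h : P.AbsCont (P.emp x)) : P.strProb n x = 2 ^ (n * P.meanLog (P.emp x)) := by
  classical
  have hpos : ∀ i : Fin n, 0 < P.prob (P.state x i) (x i) := by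
    intro i
    refine (P.prob_nonneg _ _).lt_of_ne fun h0 => ?_
    have h1 := h _ _ h0.symm
    have hn : (n : ℝ) ≠ 0 := Nat.cast_ne_zero.2 (Fin.pos i).ne'
    rw [emp, div_eq_zero_iff, or_iff_left hn, Nat.cast_eq_zero, count,
      Finset.card_eq_zero] at h1
    exact Finset.notMem_empty i (h1 ▸ by simp)
  unfold meanLog
  rw [← P.sum_along_eq_emp x fun s a => Real.logb 2 (P.prob s a), strProb,
    Real.rpow_sum_of_pos two_pos]
  exact Finset.prod_congr rfl fun i _ => (Real.rpow_logb two_pos (by norm_num) (hpos i)).symm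

omit [Fintype S] in
theorem absCont_emp_of_strProb_ne_zero (P : UnifilarSource X S) {n : ℕ} {x : Fin n → X}
    (h : P.strProb n x ≠ 0) : P.AbsCont (P.emp x) := by
  classical
  intro s a h0
  rw [emp, div_eq_zero_iff, Nat.cast_eq_zero, count, Finset.card_eq_zero]
  left
  refine Finset.filter_eq_empty_iff.2 ?_
  rintro i - ⟨rfl, rfl⟩
  exact Finset.prod_ne_zero_iff.1 h i (Finset.mem_univ i) h0

open scoped Classical in
/-- The strings of length `n` with the empirical law `Q`. -/
def typeClass (P : UnifilarSource X S) (n : ℕ) (Q : S → X → ℝ) : Finset (Fin n → X) :=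
  Finset.univ.filter fun x => P.emp x = Q

/-- Under the source tilted to `Q` each string of the class has probability exactly `2 ^ (-n H(Q))`,
and these probabilities sum to at most 1. -/
theorem card_typeClass_le (P : UnifilarSource X S) (n : ℕ) {Q : S → X → ℝ}
    (hQ : ∀ s x, 0 ≤ Q s x) : ((P.typeClass n Q).card : ℝ) ≤ 2 ^ (n * condEntropy Q) := by
  classical
  have h : ∀ x ∈ P.typeClass n Q, (P.tilt Q hQ).strProb n x = 2 ^ (-(n * condEntropy Q)) := by
    intro x hx
    -- The empirical law depends only on the next-state map and the initial state, which tilting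
    -- preserves.
    have hx' : (P.tilt Q hQ).emp x = Q := (Finset.mem_filter.1 hx).2
    rw [strProb_eq_rpow, hx', P.meanLog_tilt hQ, mul_neg]
    rw [hx']
    exact P.tilt_absCont hQ
  have h1 : ∑ x ∈ P.typeClass n Q, (P.tilt Q hQ).strProb n x ≤ 1 := by
    rw [← (P.tilt Q hQ).sum_strProb n]
    exact Finset.sum_le_univ_sum_of_nonneg fun x => strProb_nonneg _ x
  rw [Finset.sum_congr rfl h, Finset.sum_const, nsmul_eq_mul, Real.rpow_neg two_pos.le,
    ← div_eq_mul_inv, div_le_one (by positivity)] at h1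
  exact h1

theorem sum_typeClass_le (P : UnifilarSource X S) (n : ℕ) {Q : S → X → ℝ}
    (hQ : ∀ s x, 0 ≤ Q s x) (hac : P.AbsCont Q) :
    ∑ x ∈ P.typeClass n Q, P.strProb n x ≤ 2 ^ (-(n * P.realDiv Q)) := by
  classical
  have h : ∀ x ∈ P.typeClass n Q, P.strProb n x = 2 ^ (n * P.meanLog Q) := by
    intro x hx
    have hx' : P.emp x = Q := (Finset.mem_filter.1 hx).2
    rw [strProb_eq_rpow, hx']
    rwa [hx']
  rw [Finset.sum_congr rfl h, Finset.sum_const, nsmul_eq_mul]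
  calc _ ≤ (2 : ℝ) ^ (n * condEntropy Q) * 2 ^ (n * P.meanLog Q) := by
        gcongr; exact P.card_typeClass_le n hQ
    _ = _ := by
        rw [← Real.rpow_add two_pos]
        congr 1
        unfold realDiv
        ring

open scoped Classical in
/-- A sum over strings whose partial sums over type classes are bounded by `c` is bounded by `c`
times the number of types. -/
theorem sum_le_of_sum_typeClass_le (P : UnifilarSource X S) (n : ℕ) (w : (Fin n → X) → ℝ)
    (p : (S → X → ℝ) → Prop) {c : ℝ} (hc : 0 ≤ c)
    (h : ∀ x : Fin n → X, p (P.emp x) → ∑ y ∈ P.typeClass n (P.emp x), w y ≤ c) :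
    ∑ x : Fin n → X with p (P.emp x), w x ≤ (n + 1) ^ (Fintype.card S * Fintype.card X) * c := by
  let T : Finset (S → X → ℝ) := (Finset.univ.filter fun x => p (P.emp x)).image
    fun x : Fin n → X => P.emp x
  have hT : ((T.card : ℕ) : ℝ) ≤ (n + 1) ^ (Fintype.card S * Fintype.card X) := by
    -- A type is determined by its `|S| |X|` counts, each in `{0, …, n}`.
    have h1 : T ⊆ Finset.univ.image
        fun N : S → X → Fin (n + 1) => fun s a => ((N s a : ℕ) : ℝ) / n := by
      intro Q hQ
      obtain ⟨x, -, rfl⟩ := Finset.mem_image.1 hQ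
      refine Finset.mem_image.2 ⟨fun s a => ⟨P.count x s a, Nat.lt_succ_of_le (P.count_le x s a)⟩,
        Finset.mem_univ _, rfl⟩
    have h2 := (Finset.card_le_card h1).trans Finset.card_image_le
    simp only [Finset.card_univ, Fintype.card_fun, Fintype.card_fin, ← pow_mul] at h2
    rw [mul_comm]
    exact_mod_cast h2
  rw [← Finset.sum_fiberwise_of_maps_to (t := T) (g := fun x => P.emp x)
    fun x hx => Finset.mem_image_of_mem _ hx]
  calc _ ≤ ∑ Q ∈ T, c := by
        refine Finset.sum_le_sum fun Q hQ => ?_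
        obtain ⟨x, hx, rfl⟩ := Finset.mem_image.1 hQ
        have hx := (Finset.mem_filter.1 hx).2
        refine le_trans (le_of_eq ?_) (h x hx)
        refine Finset.sum_congr ?_ fun _ _ => rfl
        ext y
        simp only [typeClass, Finset.mem_filter, Finset.mem_univ, true_and]
        exact ⟨fun h => h.2, fun h => ⟨h ▸ hx, h⟩⟩
    _ ≤ _ := by
        rw [Finset.sum_const, nsmul_eq_mul]
        gcongr

end Strings

end UnifilarSource

/-! ### Large deviations of the empirical law: upper bounds -/

theorem eventually_pow_le_two_rpow (d : ℕ) {δ : ℝ} (hδ : 0 < δ) :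
    ∀ᶠ n : ℕ in atTop, ((n : ℝ) + 1) ^ d ≤ 2 ^ (n * δ) := by
  have h1 : (1 : ℝ) < 2 ^ δ := Real.one_lt_rpow one_lt_two hδ
  have h2 := (isLittleO_pow_const_const_pow_of_one_lt (R := ℝ) d h1).def
    (c := 1 / 2 ^ d) (by positivity)
  filter_upwards [h2, eventually_ge_atTop 1] with n hn hn1
  have hn1' : (1 : ℝ) ≤ n := by exact_mod_cast hn1
  rw [Real.norm_of_nonneg (by positivity), Real.norm_of_nonneg (by positivity)] at hn
  calc ((n : ℝ) + 1) ^ d ≤ (2 * n) ^ d := by gcongr; linarith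
    _ = 2 ^ d * (n : ℝ) ^ d := mul_pow _ _ _
    _ ≤ 2 ^ d * (1 / 2 ^ d * (2 ^ δ) ^ n) := by gcongr
    _ = (2 ^ δ) ^ n := by field_simp
    _ = 2 ^ (n * δ) := by rw [mul_comm, Real.rpow_mul two_pos.le, Real.rpow_natCast]

theorem eventually_le_two_rpow (C : ℝ) {δ : ℝ} (hδ : 0 < δ) :
    ∀ᶠ n : ℕ in atTop, C ≤ 2 ^ (n * δ) := by
  filter_upwards [eventually_pow_le_two_rpow 1 hδ,
    tendsto_natCast_atTop_atTop.eventually_ge_atTop C] with n h1 h2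
  rw [pow_one] at h1
  linarith

namespace UnifilarSource

variable {X S : Type*} [Fintype X] [Fintype S]

/-- A bound for stationary laws extends, by compactness, to nearly stationary ones. -/
theorem exists_gap (P : UnifilarSource X S) {g : (S → X → ℝ) → ℝ}
    (hg : ContinuousOn g (jointPMFs S X)) {b c : ℝ}
    (h : ∀ Q, P.IsStationaryPMF Q → P.AbsCont Q → P.realDiv Q ≤ c → g Q < b) :
    ∃ δ > 0, ∀ Q ∈ jointPMFs S X, (∀ t, |P.netFlow Q t| ≤ δ) → P.AbsCont Q → b - δ ≤ g Q →
      c + δ < P.realDiv Q := by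
  -- Counterexamples for `δ = 1 / (m + 1)` accumulate at a law that is exactly stationary and
  -- violates `h`.
  by_contra! hcon
  have hpos : ∀ m : ℕ, 0 < 1 / ((m : ℝ) + 1) := fun m => Nat.one_div_pos_of_nat
  choose u hu hflow hac hgu hdiv using fun m : ℕ => hcon (1 / ((m : ℝ) + 1)) (hpos m)
  obtain ⟨Q, hQ, φ, hφ, hlim⟩ := isCompact_jointPMFs.tendsto_subseq hu
  have hε : Tendsto (fun m => 1 / ((φ m : ℝ) + 1)) atTop (𝓝 0) :=
    tendsto_one_div_add_atTop_nhds_zero_nat.comp hφ.tendsto_atTop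
  have hlimW : Tendsto (u ∘ φ) atTop (𝓝[jointPMFs S X] Q) :=
    tendsto_nhdsWithin_iff.2 ⟨hlim, Eventually.of_forall fun m => hu _⟩
  have hacQ : P.AbsCont Q := by
    intro s x h0
    have h1 : Tendsto (fun m => (u ∘ φ) m s x) atTop (𝓝 (Q s x)) :=
      tendsto_pi_nhds.1 (tendsto_pi_nhds.1 hlim s) x
    refine tendsto_nhds_unique h1 (tendsto_const_nhds.congr fun m => (hac (φ m) s x h0).symm)
  have hstat : P.IsStationaryPMF Q := by
    refine (P.isStationaryPMF_iff Q).2 ⟨hQ, fun t => ?_⟩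
    have h1 : Tendsto (fun m => |P.netFlow ((u ∘ φ) m) t|) atTop (𝓝 |P.netFlow Q t|) :=
      (((P.continuous_netFlow t).tendsto Q).comp hlim).abs
    exact abs_nonpos_iff.1 (le_of_tendsto_of_tendsto' h1 hε fun m => hflow (φ m) t)
  have hdivQ : P.realDiv Q ≤ c := by
    have h1 := ((P.continuousOn_realDiv.mono fun Q hQ => hQ.1) Q hQ).tendsto.comp hlimW
    refine le_of_tendsto_of_tendsto' h1 (g := fun m => c + 1 / ((φ m : ℝ) + 1)) ?_ fun m => hdiv _
    simpa using hε.const_add c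
  have hgQ : b ≤ g Q := by
    have h1 := (hg Q hQ).tendsto.comp hlimW
    refine le_of_tendsto_of_tendsto' (f := fun m => b - 1 / ((φ m : ℝ) + 1)) ?_ h1 fun m => hgu _
    simpa using hε.const_sub b
  exact (h Q hstat hacQ hdivQ).not_ge hgQ

open scoped Classical in
/-- The upper bound of large deviations for the empirical law of a unifilar source. -/
theorem exists_sum_strProb_le (P : UnifilarSource X S) {g : (S → X → ℝ) → ℝ}
    (hg : ContinuousOn g (jointPMFs S X)) {b c : ℝ}
    (h : ∀ Q, P.IsStationaryPMF Q → P.AbsCont Q → P.realDiv Q ≤ c → g Q < b) :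
    ∃ δ > 0, ∀ᶠ n : ℕ in atTop,
      ∑ x : Fin n → X with b - δ ≤ g (P.emp x), P.strProb n x ≤ 2 ^ (-(n * (c + δ))) := by
  obtain ⟨δ, hδ, hgap⟩ := P.exists_gap hg h
  -- Half of the gap pays for the polynomial number of types.
  refine ⟨δ / 2, half_pos hδ, ?_⟩
  filter_upwards [eventually_pow_le_two_rpow (Fintype.card S * Fintype.card X) (half_pos hδ),
    tendsto_one_div_atTop_nhds_zero_nat.eventually_le_const hδ,
    eventually_gt_atTop 0] with n hpoly hn hn0
  have h1 := P.sum_le_of_sum_typeClass_le n (P.strProb n) (fun Q => b - δ / 2 ≤ g Q)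
    (c := 2 ^ (-(n * (c + δ)))) (by positivity) ?_
  · refine h1.trans ?_
    calc _ ≤ (2 : ℝ) ^ (n * (δ / 2)) * 2 ^ (-(n * (c + δ))) := by gcongr
      _ = _ := by rw [← Real.rpow_add two_pos]; congr 1; ring
  · intro x hx
    by_cases hac : P.AbsCont (P.emp x)
    · refine (P.sum_typeClass_le n (P.emp_nonneg x) hac).trans ?_
      have h2 := hgap _ (P.emp_mem_jointPMFs hn0 x)
        (fun t => (P.abs_netFlow_emp_le x t).trans hn) hac (by linarith)
      gcongr
      exact one_le_two
    -- A type that is not absolutely continuous contains only strings of probability 0.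
    · rw [Finset.sum_eq_zero]
      · positivity
      · intro y hy
        by_contra h0
        exact hac ((Finset.mem_filter.1 hy).2 ▸ P.absCont_emp_of_strProb_ne_zero h0)

/-- Every unifilar source has a stationary law. -/
theorem exists_stationary (P : UnifilarSource X S) :
    ∃ Q, P.IsStationaryPMF Q ∧ P.AbsCont Q ∧ P.realDiv Q ≤ 0 := by
  classical
  -- Otherwise the large-deviation bound with constant `g` has a vacuous hypothesis and bounds the
  -- total probability 1 by `2 ^ (-n δ)`.
  by_contra! hcon
  obtain ⟨δ, hδ, hev⟩ := P.exists_sum_strProb_le (g := fun _ => 0) continuousOn_const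
    (b := 0) (c := 0) fun Q h1 h2 h3 => absurd h3 (hcon Q h1 h2).not_ge
  obtain ⟨n, hn, hn0⟩ := (hev.and (eventually_gt_atTop 0)).exists
  rw [Finset.filter_true_of_mem fun _ _ => by linarith, P.sum_strProb, zero_add] at hn
  have hn0' : (0 : ℝ) < n := by exact_mod_cast hn0
  have : (2 : ℝ) ^ (-(n * δ)) < 1 :=
    Real.rpow_lt_one_of_one_lt_of_neg one_lt_two (by have := mul_pos hn0' hδ; linarith)
  linarith

/-- The strings of small empirical entropy: there are few of them, and the others have a small
probability. -/
theorem exists_small_set (P : UnifilarSource X S) {B c : ℝ} (h : (c : EReal) < P.errorExponent B) :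
    ∃ δ > 0, ∀ᶠ n : ℕ in atTop, ∃ A : Finset (Fin n → X),
      (A.card : ℝ) ≤ 2 ^ (n * (B - δ)) ∧
      ∑ x, P.strProb n x - ∑ x ∈ A, P.strProb n x ≤ 2 ^ (-(n * c)) := by
  classical
  obtain ⟨δ, hδ, hev⟩ := P.exists_sum_strProb_le (g := condEntropy)
    (continuousOn_condEntropy.mono fun Q hQ => hQ.1) (b := B) (c := c) fun Q h1 h2 h3 => by
      by_contra! h4
      have h5 : P.errorExponent B ≤ P.condDiv Q := sInf_le ⟨Q, h1, h4, rfl⟩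
      rw [P.condDiv_of_absCont h1.nonneg h2] at h5
      exact (h.trans_le h5).not_ge (EReal.coe_le_coe_iff.2 h3)
  refine ⟨δ / 2, half_pos hδ, ?_⟩
  filter_upwards [hev, eventually_pow_le_two_rpow (Fintype.card S * Fintype.card X) (half_pos hδ)]
    with n hn hpoly
  refine ⟨Finset.univ.filter fun x => condEntropy (P.emp x) < B - δ, ?_, ?_⟩
  · have h1 := P.sum_le_of_sum_typeClass_le n (fun _ => 1) (fun Q => condEntropy Q < B - δ)
      (c := 2 ^ (n * (B - δ))) (by positivity) ?_
    · simp only [Finset.sum_const, nsmul_eq_mul, mul_one] at h1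
      refine h1.trans ?_
      calc _ ≤ (2 : ℝ) ^ (n * (δ / 2)) * 2 ^ (n * (B - δ)) := by gcongr
        _ = _ := by rw [← Real.rpow_add two_pos]; congr 1; ring
    · intro x hx
      simp only [Finset.sum_const, nsmul_eq_mul, mul_one]
      refine (P.card_typeClass_le n (P.emp_nonneg x)).trans ?_
      gcongr
      exact one_le_two
  · rw [← Finset.sum_filter_add_sum_filter_not Finset.univ
      (fun x => condEntropy (P.emp x) < B - δ), add_sub_cancel_left]
    simp only [not_lt]
    refine hn.trans ?_
    gcongr
    · exact one_le_two
    · linarith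

end UnifilarSource

/-! ### Irreducible sources and the typical strings of a tilted source -/

namespace UnifilarSource

variable {X S : Type*} [Fintype X] [Fintype S]

open scoped Classical in
/-- In an irreducible chain, a nonnegative invariant vector with a zero vanishes. -/
theorem Irreducible.invariant_eq_zero {P : UnifilarSource X S} (hP : P.Irreducible) {ν : S → ℝ}
    (h0 : ∀ s, 0 ≤ ν s)
    (hν : ∀ t, (∑ s, ∑ x, if P.next x s = t then ν s * P.prob s x else 0) = ν t) {t : S}
    (ht : ν t = 0) (s : S) : ν s = 0 := by
  induction hP s t using Relation.ReflTransGen.head_induction_on with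
  | refl => exact ht
  | @head a b hab _ ih =>
    obtain ⟨x, hx, rfl⟩ := hab
    have hnn : ∀ s y, 0 ≤ if P.next y s = P.next x a then ν s * P.prob s y else 0 := by
      intro s y
      split_ifs
      · exact mul_nonneg (h0 s) (P.prob_nonneg s y)
      · exact le_rfl
    -- The mass carried by one transition is at most the mass of its target, so a zero propagates
    -- backwards along a path.
    have h1 : ν a * P.prob a x ≤ ν (P.next x a) := by
      rw [← hν (P.next x a)]
      calc ν a * P.prob a x
          = if P.next x a = P.next x a then ν a * P.prob a x else 0 := by simp
        _ ≤ ∑ y, if P.next y a = P.next x a then ν a * P.prob a y else 0 :=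
          Finset.single_le_sum (f := fun y => if P.next y a = P.next x a then ν a * P.prob a y else 0)
            (fun y _ => hnn a y) (Finset.mem_univ x)
        _ ≤ _ := Finset.single_le_sum
          (f := fun s => ∑ y, if P.next y s = P.next x a then ν s * P.prob s y else 0)
            (fun s _ => Finset.sum_nonneg fun y _ => hnn s y) (Finset.mem_univ a)
    rw [ih] at h1
    refine le_antisymm ?_ (h0 a)
    by_contra! h2
    exact (mul_pos h2 hx).not_ge h1

open scoped Classical in
theorem IsStationaryPMF.marginal_invariant {P : UnifilarSource X S} {Q : S → X → ℝ}
    (hQ : P.IsStationaryPMF Q) (h : ∀ s x, Q s x = stateMarginal Q s * P.prob s x) (t : S) :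
    (∑ s, ∑ x, if P.next x s = t then stateMarginal Q s * P.prob s x else 0)
      = stateMarginal Q t := by
  rw [← hQ.stationary t]
  simp only [← h]

theorem Irreducible.marginal_pos {P : UnifilarSource X S} (hP : P.Irreducible) {Q : S → X → ℝ}
    (hQ : P.IsStationaryPMF Q) (h : ∀ s x, Q s x = stateMarginal Q s * P.prob s x) (s : S) :
    0 < stateMarginal Q s := by
  refine (stateMarginal_nonneg hQ.nonneg s).lt_of_ne fun h0 => ?_
  have h1 := hP.invariant_eq_zero (stateMarginal_nonneg hQ.nonneg) (hQ.marginal_invariant h) h0.symm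
  have h2 : ∑ s, stateMarginal Q s = 1 := hQ.sum_eq_one
  rw [Finset.sum_eq_zero fun s _ => h1 s] at h2
  exact zero_ne_one h2

/-- The stationary law of an irreducible source is unique. -/
theorem Irreducible.stationary_unique {P : UnifilarSource X S} (hP : P.Irreducible)
    {Q Q' : S → X → ℝ} (hQ : P.IsStationaryPMF Q)
    (h : ∀ s x, Q s x = stateMarginal Q s * P.prob s x) (hQ' : P.IsStationaryPMF Q')
    (h' : ∀ s x, Q' s x = stateMarginal Q' s * P.prob s x) : Q = Q' := by
  classical
  have hpos := hP.marginal_pos hQ' h'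
  -- With `c` the least ratio of the marginals, `Q(s) - c Q'(s)` is nonnegative, invariant, and zero
  -- at the minimizer, hence zero everywhere.
  obtain ⟨t, -, ht⟩ := Finset.exists_min_image Finset.univ
    (fun s => stateMarginal Q s / stateMarginal Q' s) ⟨P.init, Finset.mem_univ _⟩
  set c := stateMarginal Q t / stateMarginal Q' t with hc
  have hz : ∀ s, stateMarginal Q s - c * stateMarginal Q' s = 0 := by
    refine hP.invariant_eq_zero (t := t) (fun s => ?_) (fun r => ?_) ?_
    · have := (le_div_iff₀ (hpos s)).1 (ht s (Finset.mem_univ s))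
      linarith
    · rw [← hQ.marginal_invariant h r, ← hQ'.marginal_invariant h' r, Finset.mul_sum,
        ← Finset.sum_sub_distrib]
      refine Finset.sum_congr rfl fun s _ => ?_
      rw [Finset.mul_sum, ← Finset.sum_sub_distrib]
      refine Finset.sum_congr rfl fun x _ => ?_
      split_ifs <;> ring
    · rw [hc, div_mul_cancel₀ _ (hpos t).ne', sub_self]
  have h1 : ∑ s, stateMarginal Q s = 1 := hQ.sum_eq_one
  have h2 : ∑ s, stateMarginal Q' s = 1 := hQ'.sum_eq_one
  have hc1 : c = 1 := by
    have h3 := Finset.sum_eq_zero fun s (_ : s ∈ Finset.univ) => hz s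
    rw [Finset.sum_sub_distrib, ← Finset.mul_sum, h1, h2] at h3
    linarith
  funext s x
  have := hz s
  rw [hc1, one_mul, sub_eq_zero] at this
  rw [h, h', this]

omit [Fintype S] in
theorem mix_marginal {Q Q' : S → X → ℝ} (a b : ℝ) (s : S) :
    stateMarginal (a • Q + b • Q') s = a * stateMarginal Q s + b * stateMarginal Q' s := by
  simp [stateMarginal, Finset.sum_add_distrib, Finset.mul_sum]

theorem IsStationaryPMF.mix {P : UnifilarSource X S} {Q Q' : S → X → ℝ}
    (hQ : P.IsStationaryPMF Q) (hQ' : P.IsStationaryPMF Q') {a b : ℝ} (ha : 0 ≤ a) (hb : 0 ≤ b)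
    (hab : a + b = 1) : P.IsStationaryPMF (a • Q + b • Q') := by
  classical
  refine ⟨fun s x => ?_, ?_, fun t => ?_⟩
  · exact add_nonneg (mul_nonneg ha (hQ.nonneg s x)) (mul_nonneg hb (hQ'.nonneg s x))
  · have h := hQ.sum_eq_one
    have h' := hQ'.sum_eq_one
    simp only [Pi.add_apply, Pi.smul_apply, smul_eq_mul, Finset.sum_add_distrib,
      ← Finset.mul_sum, h, h', mul_one, hab]
  · rw [mix_marginal, ← hQ.stationary t, ← hQ'.stationary t, Finset.mul_sum, Finset.mul_sum,
      ← Finset.sum_add_distrib]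
    refine Finset.sum_congr rfl fun s _ => ?_
    rw [Finset.mul_sum, Finset.mul_sum, ← Finset.sum_add_distrib]
    refine Finset.sum_congr rfl fun x _ => ?_
    split_ifs <;> simp

omit [Fintype S] in
theorem AbsCont.mix {P : UnifilarSource X S} {Q Q' : S → X → ℝ}
    (hQ : P.AbsCont Q) (hQ' : P.AbsCont Q') (a b : ℝ) : P.AbsCont (a • Q + b • Q') := by
  intro s x h
  simp [hQ s x h, hQ' s x h]

theorem meanLog_mix (P : UnifilarSource X S) (Q Q' : S → X → ℝ) (a b : ℝ) :
    P.meanLog (a • Q + b • Q') = a * P.meanLog Q + b * P.meanLog Q' := by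
  simp only [meanLog, Pi.add_apply, Pi.smul_apply, smul_eq_mul, add_mul, Finset.sum_add_distrib,
    Finset.mul_sum, mul_assoc]

/-- Concavity of the conditional entropy. -/
theorem le_condEntropy_mix (P : UnifilarSource X S) {Q Q' : S → X → ℝ} (hQ : ∀ s x, 0 ≤ Q s x)
    (hQ' : ∀ s x, 0 ≤ Q' s x) {a b : ℝ} (ha : 0 < a) (hb : 0 < b) :
    a * condEntropy Q + b * condEntropy Q' ≤ condEntropy (a • Q + b • Q') := by
  have hnn : ∀ s x, 0 ≤ (a • Q + b • Q') s x := fun s x =>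
    add_nonneg (mul_nonneg ha.le (hQ s x)) (mul_nonneg hb.le (hQ' s x))
  -- Tilt to the mixture: the cross-entropy is linear, equals the entropy at the mixture, and
  -- dominates the entropy at `Q` and at `Q'`. The strict positivity of `a` and `b` keeps both
  -- absolutely continuous.
  have hac := P.tilt_absCont hnn
  have hac1 : (P.tilt _ hnn).AbsCont Q := by
    intro s x h
    have h1 : a * Q s x + b * Q' s x = 0 := hac s x h
    have := mul_nonneg ha.le (hQ s x)
    have := mul_nonneg hb.le (hQ' s x)
    exact (mul_eq_zero.1 (by linarith : a * Q s x = 0)).resolve_left ha.ne'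
  have hac2 : (P.tilt _ hnn).AbsCont Q' := by
    intro s x h
    have h1 : a * Q s x + b * Q' s x = 0 := hac s x h
    have := mul_nonneg ha.le (hQ s x)
    have := mul_nonneg hb.le (hQ' s x)
    exact (mul_eq_zero.1 (by linarith : b * Q' s x = 0)).resolve_left hb.ne'
  have h1 := mul_le_mul_of_nonneg_left
    ((P.tilt _ hnn).condEntropy_le_neg_meanLog hQ hac1) ha.le
  have h2 := mul_le_mul_of_nonneg_left
    ((P.tilt _ hnn).condEntropy_le_neg_meanLog hQ' hac2) hb.le
  have h3 := P.meanLog_tilt hnn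
  rw [meanLog_mix] at h3
  linarith

omit [Fintype X] [Fintype S] in
theorem tendsto_mix (Q Q' : S → X → ℝ) :
    Tendsto (fun a : ℝ => (1 - a) • Q + a • Q') (𝓝[>] 0) (𝓝 Q) := by
  have h : Continuous fun a : ℝ => (1 - a) • Q + a • Q' := by fun_prop
  have := (h.tendsto 0).mono_left (nhdsWithin_le_nhds (s := Set.Ioi 0))
  simpa using this

omit [Fintype X] [Fintype S] in
theorem tendsto_comp_mix {g : (S → X → ℝ) → ℝ} (hg : ContinuousOn g {Q | ∀ s x, 0 ≤ Q s x})
    {Q Q' : S → X → ℝ} (hQ : ∀ s x, 0 ≤ Q s x) (hQ' : ∀ s x, 0 ≤ Q' s x) :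
    Tendsto (fun a : ℝ => g ((1 - a) • Q + a • Q')) (𝓝[>] 0) (𝓝 (g Q)) := by
  refine (hg Q hQ).tendsto.comp (tendsto_nhdsWithin_iff.2 ⟨tendsto_mix Q Q', ?_⟩)
  filter_upwards [self_mem_nhdsWithin, nhdsWithin_le_nhds (eventually_le_nhds zero_lt_one)]
    with a ha ha1 s x
  exact add_nonneg (mul_nonneg (sub_nonneg.2 ha1) (hQ s x))
    (mul_nonneg (le_of_lt ha) (hQ' s x))

/-- If `B` is not the largest attainable entropy, then a law that nearly attains the error exponent
can be chosen with entropy above `B` and with full support. -/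
theorem Irreducible.exists_good_law {P : UnifilarSource X S} (hP : P.Irreducible) {B d : ℝ}
    (hB : ¬ IsGreatest P.attainableEntropies B) (h : P.errorExponent B < d) :
    ∃ Q, P.IsStationaryPMF Q ∧ P.AbsCont Q ∧ B < condEntropy Q ∧ P.realDiv Q < d ∧
      ∀ s x, 0 < P.prob s x → 0 < Q s x := by
  obtain ⟨_, ⟨Q, hQ, hBQ, rfl⟩, hdiv⟩ := sInf_lt_iff.1 h
  have hac := P.absCont_of_condDiv_lt_top (hdiv.trans (EReal.coe_lt_top d))
  have hdiv' := hdiv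
  rw [P.condDiv_of_absCont hQ.nonneg hac, EReal.coe_lt_coe_iff] at hdiv'
  obtain ⟨Q₁, hQ₁, hac₁, hBQ₁⟩ :
      ∃ Q₁, P.IsStationaryPMF Q₁ ∧ P.AbsCont Q₁ ∧ B < condEntropy Q₁ := by
    rcases hBQ.lt_or_eq with hlt | heq
    · exact ⟨Q, hQ, hac, hlt⟩
    · by_contra! hcon
      refine hB ⟨⟨Q, hQ, hdiv.trans (EReal.coe_lt_top d), heq.symm⟩, ?_⟩
      rintro _ ⟨Q₁, h1, h2, rfl⟩
      exact hcon Q₁ h1 (P.absCont_of_condDiv_lt_top h2)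
  obtain ⟨Q₀, hQ₀, hac₀, hdiv₀⟩ := P.exists_stationary
  have hQ₀' := P.eq_marginal_mul_prob_of_realDiv_nonpos hQ₀.nonneg hac₀ hdiv₀
  have hev1 := (tendsto_comp_mix continuousOn_condEntropy hQ₁.nonneg hQ₀.nonneg).eventually
    (eventually_gt_nhds hBQ₁)
  have hsmall : ∀ᶠ a : ℝ in 𝓝[>] 0, 0 < a ∧ a < 1 := by
    filter_upwards [self_mem_nhdsWithin, nhdsWithin_le_nhds (eventually_lt_nhds zero_lt_one)]
      with a ha ha1 using ⟨ha, ha1⟩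
  -- A small admixture of the stationary law `Q₀` gives full support without losing entropy above
  -- `B`.
  obtain ⟨a, ha, ha0, ha1⟩ := (hev1.and hsmall).exists
  set Q₂ := (1 - a) • Q₁ + a • Q₀ with hQ₂def
  have hQ₂ : P.IsStationaryPMF Q₂ := hQ₁.mix hQ₀ (by linarith) ha0.le (by ring)
  have hac₂ : P.AbsCont Q₂ := hac₁.mix hac₀ _ _
  have hev2 := (tendsto_comp_mix P.continuousOn_realDiv hQ.nonneg hQ₂.nonneg).eventually
    (eventually_lt_nhds hdiv')
  -- A small admixture of `Q₂` keeps the divergence below `d` by continuity; concavity makes the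
  -- entropy exceed `B` for every `e` in `(0, 1)`.
  obtain ⟨e, he, he0, he1⟩ := (hev2.and hsmall).exists
  refine ⟨(1 - e) • Q + e • Q₂, hQ.mix hQ₂ (by linarith) he0.le (by ring), hac.mix hac₂ _ _,
    ?_, he, fun s x hsx => ?_⟩
  · refine lt_of_lt_of_le ?_
      (P.le_condEntropy_mix hQ.nonneg hQ₂.nonneg (sub_pos.2 he1) he0)
    have h1 := mul_le_mul_of_nonneg_left hBQ (sub_pos.2 he1).le
    have h2 := mul_lt_mul_of_pos_left ha he0
    linarith
  · have h0 : 0 < Q₀ s x := by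
      rw [hQ₀']
      exact mul_pos (hP.marginal_pos hQ₀ hQ₀' s) hsx
    have h2 : 0 < Q₂ s x := add_pos_of_nonneg_of_pos
      (mul_nonneg (by linarith) (hQ₁.nonneg s x)) (mul_pos ha0 h0)
    exact add_pos_of_nonneg_of_pos (mul_nonneg (by linarith) (hQ.nonneg s x)) (mul_pos he0 h2)

/-- Many strings of comparable probability, whose total probability is not much less than
`2 ^ (-n F(B))`. -/
theorem Irreducible.exists_large_set {P : UnifilarSource X S} (hP : P.Irreducible) {B d : ℝ}
    (hB : ¬ IsGreatest P.attainableEntropies B) (h : P.errorExponent B < d) :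
    ∃ δ > 0, ∀ᶠ n : ℕ in atTop, ∃ T : Finset (Fin n → X), ∃ w : ℝ, 0 ≤ w ∧
      (2 : ℝ) ^ (n * (B + δ)) ≤ T.card ∧ (∀ x ∈ T, w ≤ P.strProb n x) ∧
      2 ^ (-(n * d)) ≤ w * T.card / 4 := by
  classical
  obtain ⟨Q, hQ, hac, hBQ, hdiv, hpos⟩ := hP.exists_good_law hB h
  -- The cardinality of `T` costs `2 ε` in the exponent and the probability of each string one more.
  obtain ⟨ε, hε, hεB, hεd⟩ : ∃ ε > 0, B < condEntropy Q - 2 * ε ∧ P.realDiv Q + 3 * ε < d := by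
    refine ⟨min (condEntropy Q - B) (d - P.realDiv Q) / 4, ?_, ?_, ?_⟩
    · have := lt_min (sub_pos.2 hBQ) (sub_pos.2 hdiv)
      linarith
    · have := lt_min (sub_pos.2 hBQ) (sub_pos.2 hdiv)
      have := min_le_left (condEntropy Q - B) (d - P.realDiv Q)
      linarith
    · have := lt_min (sub_pos.2 hBQ) (sub_pos.2 hdiv)
      have := min_le_right (condEntropy Q - B) (d - P.realDiv Q)
      linarith
  set P' := P.tilt Q hQ.nonneg with hP'def
  have hP'prob : ∀ s x, 0 < P.prob s x → 0 < P'.prob s x := by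
    intro s x hsx
    have h1 := hpos s x hsx
    exact (P'.prob_nonneg s x).lt_of_ne fun h0 =>
      h1.ne' (P.tilt_absCont hQ.nonneg s x h0.symm)
  have hirr : P'.Irreducible := fun s t =>
    Relation.ReflTransGen.mono (fun a b ⟨x, hx, hab⟩ => ⟨x, hP'prob a x hx, hab⟩) s t (hP s t)
  have hQP' : P'.IsStationaryPMF Q := ⟨hQ.nonneg, hQ.sum_eq_one, hQ.stationary⟩
  have hmean : P'.meanLog Q = -condEntropy Q := P.meanLog_tilt hQ.nonneg
  have hQdiv : P'.realDiv Q ≤ 0 := by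
    unfold realDiv
    rw [hmean]
    linarith
  -- As `Q` charges every state, `P'` vanishes wherever `Q` does, in particular wherever `P` does.
  have hacP : ∀ Q', P'.AbsCont Q' → P.AbsCont Q' := by
    intro Q' h' s x h0
    refine h' s x ?_
    have h1 := P'.eq_marginal_mul_prob_of_realDiv_nonpos hQ.nonneg
      (P.tilt_absCont hQ.nonneg) hQdiv s x
    rw [hac s x h0] at h1
    refine (mul_eq_zero.1 h1.symm).resolve_left ?_
    exact (hirr.marginal_pos hQP' (P'.eq_marginal_mul_prob_of_realDiv_nonpos hQ.nonneg
      (P.tilt_absCont hQ.nonneg) hQdiv) s).ne'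
  obtain ⟨η, hη, hball⟩ : ∃ η > 0, ∀ Q', dist Q' Q < η →
      |P.meanLog Q' - P.meanLog Q| < ε ∧ |P'.meanLog Q' - P'.meanLog Q| < ε := by
    obtain ⟨η₁, h1, h1'⟩ := Metric.continuous_iff.1 P.continuous_meanLog Q ε hε
    obtain ⟨η₂, h2, h2'⟩ := Metric.continuous_iff.1 P'.continuous_meanLog Q ε hε
    exact ⟨min η₁ η₂, lt_min h1 h2, fun Q' h => ⟨h1' Q' (h.trans_le (min_le_left _ _)),
      h2' Q' (h.trans_le (min_le_right _ _))⟩⟩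
  -- The law of large numbers under `P'`: `Q` is its only stationary law of zero divergence, so
  -- empirical laws away from `Q` are exponentially unlikely.
  obtain ⟨δ, hδ, hev⟩ := P'.exists_sum_strProb_le (g := fun Q' => dist Q' Q)
    (by fun_prop) (b := η) (c := 0) fun Q' h1 h2 h3 => by
      rw [hirr.stationary_unique h1
        (P'.eq_marginal_mul_prob_of_realDiv_nonpos h1.nonneg h2 h3) hQP'
        (P'.eq_marginal_mul_prob_of_realDiv_nonpos hQ.nonneg
          (P.tilt_absCont hQ.nonneg) hQdiv), dist_self]
      exact hη
  refine ⟨condEntropy Q - 2 * ε - B, by linarith, ?_⟩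
  -- The 2 leaves mass at least `1 / 2` on `T`; the 8 absorbs that half and the factor 4 in `hcard`.
  filter_upwards [hev, eventually_le_two_rpow 2 hδ, eventually_le_two_rpow 8 hε]
    with n hn hn2 hn8
  set T : Finset (Fin n → X) := Finset.univ.filter fun x =>
    dist (P'.emp x) Q < η ∧ P'.strProb n x ≠ 0 with hT
  have hmem : ∀ x ∈ T, dist (P'.emp x) Q < η ∧ P'.AbsCont (P'.emp x) := fun x hx =>
    ⟨(Finset.mem_filter.1 hx).2.1,
      P'.absCont_emp_of_strProb_ne_zero (Finset.mem_filter.1 hx).2.2⟩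
  have hhalf : 1 / 2 ≤ ∑ x ∈ T, P'.strProb n x := by
    have h1 := P'.sum_strProb n
    rw [← Finset.sum_filter_add_sum_filter_not Finset.univ
      (fun x => η - δ ≤ dist (P'.emp x) Q)] at h1
    have h2 : (2 : ℝ) ^ (-(n * (0 + δ))) ≤ 1 / 2 := by
      rw [zero_add, Real.rpow_neg two_pos.le, ← one_div]
      exact one_div_le_one_div_of_le two_pos hn2
    have h3 : ∑ x : Fin n → X with ¬ (η - δ ≤ dist (P'.emp x) Q), P'.strProb n x
        ≤ ∑ x ∈ T, P'.strProb n x := by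
      rw [← Finset.sum_filter_ne_zero]
      refine Finset.sum_le_sum_of_subset_of_nonneg ?_ fun x _ _ => P'.strProb_nonneg x
      intro x hx
      simp only [Finset.mem_filter, Finset.mem_univ, true_and, not_le] at hx
      simp only [hT, Finset.mem_filter, Finset.mem_univ, true_and]
      exact ⟨by linarith [hx.1], hx.2⟩
    linarith
  have hcard : (2 : ℝ) ^ (n * (condEntropy Q - 2 * ε)) * 4 ≤ T.card := by
    have h1 : ∀ x ∈ T, P'.strProb n x ≤ 2 ^ (n * (-condEntropy Q + ε)) := by
      intro x hx
      rw [P'.strProb_eq_rpow x (hmem x hx).2]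
      have := (abs_lt.1 (hball _ (hmem x hx).1).2).2
      gcongr
      · exact one_le_two
      · linarith
    have h2 := hhalf.trans (Finset.sum_le_card_nsmul T _ _ h1)
    rw [nsmul_eq_mul] at h2
    have h3 : (2 : ℝ) ^ (n * (condEntropy Q - 2 * ε)) * 2 ^ (n * ε)
        * 2 ^ (n * (-condEntropy Q + ε)) = 1 := by
      rw [← Real.rpow_add two_pos, ← Real.rpow_add two_pos, ← Real.rpow_zero 2]
      congr 1
      ring
    have h4 : (0 : ℝ) < 2 ^ (n * (-condEntropy Q + ε)) := by positivity
    have h5 : (0 : ℝ) < 2 ^ (n * (condEntropy Q - 2 * ε)) := by positivity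
    refine le_of_mul_le_mul_right ?_ h4
    refine le_trans ?_ h2
    have h6 := mul_le_mul_of_nonneg_left hn8 (mul_pos h5 h4).le
    nlinarith
  have hcard' : (2 : ℝ) ^ (n * (condEntropy Q - 2 * ε)) ≤ T.card / 4 := by linarith
  refine ⟨T, 2 ^ (n * (P.meanLog Q - ε)), by positivity, ?_, fun x hx => ?_, ?_⟩
  · rw [show B + (condEntropy Q - 2 * ε - B) = condEntropy Q - 2 * ε by ring]
    have : (0 : ℝ) ≤ T.card := by positivity
    linarith
  · have hempeq : P'.emp x = P.emp x := rfl
    rw [P.strProb_eq_rpow x (hacP _ (hempeq ▸ (hmem x hx).2))]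
    have := (abs_lt.1 (hball _ (hmem x hx).1).1).1
    rw [hempeq] at this
    gcongr
    · exact one_le_two
    · linarith
  · rw [mul_div_assoc]
    calc (2 : ℝ) ^ (-(n * d))
        ≤ 2 ^ (n * (P.meanLog Q - ε)) * 2 ^ (n * (condEntropy Q - 2 * ε)) := by
          rw [← Real.rpow_add two_pos, ← mul_neg, ← mul_add]
          unfold realDiv at hεd
          gcongr
          · exact one_le_two
          · linarith
      _ ≤ _ := by gcongr

end UnifilarSource

/-! ### Optimality of the guessing order and upper bounds for the guess tail -/

section Attack

variable {M : Type*} [Fintype M] {k : ℕ}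

omit [Fintype M] in
theorem jointProb_nonneg {p : M → ℝ} (hp : ∀ x, 0 ≤ p x) (f : Encryption M k) (x : M)
    (y : List Bool) : 0 ≤ jointProb p f x y := by
  refine Finset.sum_nonneg fun u _ => ?_
  have := hp x
  split_ifs <;> positivity

/-- For fixed `y` the posterior is the joint probability up to a constant factor; if `y` has
probability 0, all joint probabilities vanish. -/
theorem jointProb_antitone {p : M → ℝ} (hp : ∀ x, 0 ≤ p x) (f : Encryption M k)
    (y : List Bool) : Antitone fun i =>
      jointProb p f ((exists_optimalOrder p f y).choose.symm i) y := by
  intro i j hij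
  have h := (exists_optimalOrder p f y).choose_spec hij
  simp only [posterior] at h
  have h0 : 0 ≤ ∑ x', jointProb p f x' y :=
    Finset.sum_nonneg fun x _ => jointProb_nonneg hp f x y
  rcases h0.eq_or_lt with h1 | h1
  · have h2 := (Finset.sum_eq_zero_iff_of_nonneg fun x _ => jointProb_nonneg hp f x y).1 h1.symm
    simp [h2]
  · exact (div_le_div_iff_of_pos_right h1).1 h

/-- The optimal attack is at least as good as any other. -/
theorem sum_jointProb_le {p : M → ℝ} (hp : ∀ x, 0 ≤ p x) (f : Encryption M k) (y : List Bool)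
    {t : ℝ} (A : Finset M) (hA : (A.card : ℝ) < t) :
    ∑ x ∈ A, jointProb p f x y
      ≤ ∑ x, if t ≤ (optimalGuess p f x y : ℝ) then 0 else jointProb p f x y := by
  classical
  have hanti := jointProb_antitone hp f y
  set e := (exists_optimalOrder p f y).choose with he
  have hcard : A.card ≤ Fintype.card M := Finset.card_le_univ A
  -- The first `A.card` messages of the optimal order, to be compared with `A` by exchange.
  let A' : Finset M := Finset.univ.map ((Fin.castLEEmb hcard).trans e.symm.toEmbedding)
  have hmem : ∀ x, x ∈ A' ↔ (e x : ℕ) < A.card := by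
    intro x
    simp only [A', Finset.mem_map, Finset.mem_univ, true_and, Function.Embedding.trans_apply,
      Equiv.coe_toEmbedding, Equiv.symm_apply_eq]
    constructor
    · rintro ⟨i, hi⟩
      rw [← hi]
      exact i.2
    · intro h
      exact ⟨⟨e x, h⟩, rfl⟩
  have hA' : A'.card = A.card := by simp [A']
  have h1 : ∑ x ∈ A', jointProb p f x y
      ≤ ∑ x, if t ≤ (optimalGuess p f x y : ℝ) then 0 else jointProb p f x y := by
    rw [← Finset.sum_filter_add_sum_filter_not Finset.univ (· ∈ A')]
    refine le_add_of_le_of_nonneg (le_of_eq ?_) (Finset.sum_nonneg fun x _ => ?_)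
    · refine (Finset.sum_congr (by ext; simp) fun x hx => ?_)
      -- Positions start at 0 and guesses at 1, so a position below `A.card` is a guess number at
      -- most `A.card`.
      have h2 : optimalGuess p f x y ≤ A.card :=
        (hmem x).1 (by simpa using hx)
      have h3 : (optimalGuess p f x y : ℝ) ≤ A.card := by exact_mod_cast h2
      rw [if_neg (by linarith)]
    · split_ifs
      · exact le_rfl
      · exact jointProb_nonneg hp f x y
  refine le_trans ?_ h1
  rcases hcard.eq_or_lt with h2 | h2
  · rw [Finset.eq_univ_of_card A h2, Finset.eq_univ_of_card A' (hA'.trans h2)]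
  -- `τ` separates the two sides: it is at most the joint probabilities in `A'` and at least those
  -- outside.
  · set τ := jointProb p f (e.symm ⟨A.card, h2⟩) y
    have hin : ∀ x ∈ A', 0 ≤ jointProb p f x y - τ := by
      intro x hx
      have h3 : e x ≤ ⟨A.card, h2⟩ := Fin.le_def.2 ((hmem x).1 hx).le
      have h4 := hanti h3
      simp only [Equiv.symm_apply_apply] at h4
      exact sub_nonneg.2 h4
    have hout : ∀ x, x ∉ A' → jointProb p f x y - τ ≤ 0 := by
      intro x hx
      have h3 : ⟨A.card, h2⟩ ≤ e x := Fin.le_def.2 (not_lt.1 fun h => hx ((hmem x).2 h))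
      have h4 := hanti h3
      simp only [Equiv.symm_apply_apply] at h4
      exact sub_nonpos.2 h4
    have h3 : ∑ x ∈ A, (jointProb p f x y - τ) ≤ ∑ x ∈ A', (jointProb p f x y - τ) := by
      rw [← Finset.sum_inter_add_sum_sdiff A A']
      have h5 : ∑ x ∈ A ∩ A', (jointProb p f x y - τ) ≤ ∑ x ∈ A', (jointProb p f x y - τ) :=
        Finset.sum_le_sum_of_subset_of_nonneg Finset.inter_subset_right fun x hx _ => hin x hx
      have h6 : ∑ x ∈ A \ A', (jointProb p f x y - τ) ≤ 0 :=
        Finset.sum_nonpos fun x hx => hout x (Finset.mem_sdiff.1 hx).2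
      linarith
    rw [Finset.sum_sub_distrib, Finset.sum_sub_distrib, Finset.sum_const, Finset.sum_const,
      hA'] at h3
    linarith

/-- Regrouping by cryptogram allows the attack to be analysed for each `y` separately; only the
finitely many cryptograms that occur enter. -/
theorem sum_eq_sum_jointProb (p : M → ℝ) (f : Encryption M k) (c : M → List Bool → Prop)
    [∀ x y, Decidable (c x y)] :
    ∑ x, ∑ u : Fin k → Bool, (if c x (f.enc x u) then p x / 2 ^ k else 0)
      = ∑ y ∈ Finset.univ.image fun xu : M × (Fin k → Bool) => f.enc xu.1 xu.2,
          ∑ x, if c x y then jointProb p f x y else 0 := by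
  symm
  rw [Finset.sum_comm]
  refine Finset.sum_congr rfl fun x _ => ?_
  have h : ∀ y, (if c x y then jointProb p f x y else 0)
      = ∑ u : Fin k → Bool, if f.enc x u = y then (if c x y then p x / 2 ^ k else 0) else 0 := by
    intro y
    unfold jointProb
    split_ifs
    · rfl
    · simp
  simp only [h]
  rw [Finset.sum_comm]
  refine Finset.sum_congr rfl fun u _ => ?_
  rw [Finset.sum_ite_eq, if_pos]
  exact Finset.mem_image.2 ⟨(x, u), Finset.mem_univ _, rfl⟩

/-- The optimal attack is at least as good as guessing the members of `A y` first. -/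
theorem guessTail_le {p : M → ℝ} (hp : ∀ x, 0 ≤ p x) (f : Encryption M k) {t : ℝ}
    (A : List Bool → Finset M) (hA : ∀ y, ((A y).card : ℝ) < t) [DecidableEq M] :
    guessTail p f t ≤
      ∑ x, ∑ u : Fin k → Bool, if x ∉ A (f.enc x u) then p x / 2 ^ k else 0 := by
  unfold guessTail
  rw [sum_eq_sum_jointProb p f fun x y => t ≤ (optimalGuess p f x y : ℝ),
    sum_eq_sum_jointProb p f fun x y => x ∉ A y]
  refine Finset.sum_le_sum fun y _ => ?_
  have h := sum_jointProb_le hp f y (A y) (hA y)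
  have h1 : ∑ x ∈ A y, jointProb p f x y + ∑ x, (if x ∉ A y then jointProb p f x y else 0)
      = ∑ x, jointProb p f x y := by
    rw [← Finset.sum_filter, ← Finset.sum_filter_add_sum_filter_not Finset.univ (· ∈ A y)]
    congr 1
    exact Finset.sum_congr (by ext; simp) fun _ _ => rfl
  have h2 : (∑ x, if t ≤ (optimalGuess p f x y : ℝ) then 0 else jointProb p f x y)
      + (∑ x, if t ≤ (optimalGuess p f x y : ℝ) then jointProb p f x y else 0)
      = ∑ x, jointProb p f x y := by
    rw [← Finset.sum_add_distrib]
    refine Finset.sum_congr rfl fun x _ => ?_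
    split_ifs <;> simp
  linarith

theorem guessTail_nonneg {p : M → ℝ} (hp : ∀ x, 0 ≤ p x) (f : Encryption M k) (t : ℝ) :
    0 ≤ guessTail p f t := by
  refine Finset.sum_nonneg fun x _ => Finset.sum_nonneg fun u _ => ?_
  have := hp x
  split_ifs <;> positivity

/-- The competing attack ignores the cryptogram and guesses `A` first. -/
theorem guessTail_le_sub {p : M → ℝ} (hp : ∀ x, 0 ≤ p x) (f : Encryption M k) {t : ℝ}
    (A : Finset M) (hA : (A.card : ℝ) < t) :
    guessTail p f t ≤ ∑ x, p x - ∑ x ∈ A, p x := by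
  classical
  refine (guessTail_le hp f (fun _ => A) fun _ => hA).trans (le_of_eq ?_)
  rw [eq_sub_iff_add_eq, ← Finset.sum_filter_add_sum_filter_not Finset.univ (· ∈ A) p, add_comm]
  congr 1
  · exact Finset.sum_congr (by ext; simp) fun _ _ => rfl
  · rw [Finset.sum_filter]
    refine Finset.sum_congr rfl fun x _ => ?_
    split_ifs
    · simp
    · rw [Finset.sum_const, nsmul_eq_mul]
      simp
      field_simp

/-- The optimal attack never needs more guesses than there are keys. -/
theorem guessTail_eq_zero {p : M → ℝ} (hp : ∀ x, 0 ≤ p x) (f : Encryption M k) {t : ℝ}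
    (ht : 2 ^ k < t) : guessTail p f t = 0 := by
  classical
  refine le_antisymm ?_ (guessTail_nonneg hp f t)
  refine (guessTail_le hp f (fun y => Finset.univ.filter fun x => ∃ u, f.enc x u = y)
    fun y => ?_).trans (le_of_eq ?_)
  · refine lt_of_le_of_lt ?_ ht
    have h : (Finset.univ.filter fun x => ∃ u, f.enc x u = y).card
        ≤ (Finset.univ : Finset (Fin k → Bool)).card := by
      -- Choosing a key for each compatible message is injective, since a key and `y` determine the
      -- message.
      have hex : ∀ x : {x // ∃ u, f.enc x u = y}, ∃ u, f.enc x.1 u = y := fun x => x.2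
      choose g hg using hex
      rw [← Fintype.card_subtype, Finset.card_univ]
      refine Fintype.card_le_of_injective g fun x x' hxx' => Subtype.ext ?_
      refine f.enc_injective (g x) ?_
      simp only
      rw [hg x, hxx', hg x']
    simp only [Finset.card_univ, Fintype.card_fun, Fintype.card_bool, Fintype.card_fin] at h
    exact_mod_cast h
  · refine Finset.sum_eq_zero fun x _ => Finset.sum_eq_zero fun u _ => if_neg ?_
    simp

end Attack

/-! ### A block one-time pad that defeats the attacker -/

section Cipher

variable {M : Type*} [Fintype M]

/-- At least `N - t` of any `N` messages need at least `t` guesses. -/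
theorem le_card_filter_guess {k : ℕ} (p : M → ℝ) (f : Encryption M k) (y : List Bool) {t : ℝ}
    (ht : 0 ≤ t) {ι : Type*} [Fintype ι] {g : ι → M} (hg : Function.Injective g) :
    (Fintype.card ι : ℝ) - t
      ≤ (Finset.univ.filter fun i => t ≤ (optimalGuess p f (g i) y : ℝ)).card := by
  classical
  have h1 := Finset.card_filter_add_card_filter_not (s := (Finset.univ : Finset ι))
    (fun i => t ≤ (optimalGuess p f (g i) y : ℝ))
  have h2 : (Finset.univ.filter fun i => ¬ t ≤ (optimalGuess p f (g i) y : ℝ)).card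
      ≤ (Finset.range ⌊t⌋₊).card := by
    -- Guess numbers below `t` correspond to distinct positions below `⌊t⌋₊`.
    refine Finset.card_le_card_of_injOn (fun i => ((exists_optimalOrder p f y).choose (g i) : ℕ))
      ?_ ?_
    · intro i hi
      have h3 := (Finset.mem_filter.1 hi).2
      simp only [Finset.coe_range, Set.mem_Iio]
      exact Nat.le_floor (not_le.1 h3).le
    · intro i _ j _ hij
      exact hg ((exists_optimalOrder p f y).choose.injective (Fin.ext hij))
  rw [Finset.card_range] at h2
  have h3 : ((Finset.univ.filter fun i => ¬ t ≤ (optimalGuess p f (g i) y : ℝ)).card : ℝ) ≤ t :=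
    (Nat.cast_le.2 h2).trans (Nat.floor_le ht)
  rw [Finset.card_univ] at h1
  have h4 : ((Finset.univ.filter fun i => t ≤ (optimalGuess p f (g i) y : ℝ)).card : ℝ)
      + (Finset.univ.filter fun i => ¬ t ≤ (optimalGuess p f (g i) y : ℝ)).card
      = Fintype.card ι := by exact_mod_cast h1
  linarith

/-- Bitwise addition of a key. -/
def xorPerm {k : ℕ} (u : Fin k → Bool) : Equiv.Perm (Fin k → Bool) where
  toFun v i := xor (v i) (u i)
  invFun v i := xor (v i) (u i)
  left_inv v := by funext i; simp
  right_inv v := by funext i; simp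

theorem xorPerm_comm {k : ℕ} (u v : Fin k → Bool) : xorPerm u v = xorPerm v u := by
  funext i; simp [xorPerm, Bool.xor_comm]

/-- The cipher that leaves the messages outside the range of `g` as they are, and adds the first
`k` key bits to the second coordinate of the others. -/
def blockCipher {k l m : ℕ} (c : M ↪ List Bool) (T : M → Prop) [DecidablePred T]
    (g : Fin m × (Fin k → Bool) ≃ Subtype T) : Encryption M (k + l) where
  enc x u := c (Equiv.Perm.extendDomain
    ((Equiv.refl (Fin m)).prodCongr (xorPerm fun i => u (Fin.castAdd l i))) g x)
  enc_injective _ := c.injective.comp (Equiv.injective _)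

omit [Fintype M] in
theorem blockCipher_enc {k l m : ℕ} (c : M ↪ List Bool) (T : M → Prop) [DecidablePred T]
    (g : Fin m × (Fin k → Bool) ≃ Subtype T) (j : Fin m) (v : Fin k → Bool)
    (u : Fin (k + l) → Bool) : (blockCipher (l := l) c T g).enc (g (j, v)) u
      = c (g (j, xorPerm (fun i => u (Fin.castAdd l i)) v)) := by
  unfold blockCipher
  simp only
  rw [Equiv.Perm.extendDomain_apply_image]
  rfl

/-- Replace each probability in the blocks by its lower bound `w`. The padded position is then
uniform whatever the message in the block, so for each cryptogram at least `2 ^ k - t` of the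
block's messages need `t` guesses. -/
theorem le_guessTail_blockCipher {k l m : ℕ} (c : M ↪ List Bool) (T : M → Prop) [DecidablePred T]
    (g : Fin m × (Fin k → Bool) ≃ Subtype T) {p : M → ℝ} (hp : ∀ x, 0 ≤ p x) {w t : ℝ}
    (hw : 0 ≤ w) (ht : 0 ≤ t) (hpw : ∀ x, T x → w ≤ p x) :
    w * m * (2 ^ k - t) ≤ guessTail p (blockCipher (l := l) c T g) t := by
  classical
  set f := blockCipher (l := l) c T g with hf
  have hinj : ∀ j, Function.Injective fun v => (g (j, v) : M) := by
    intro j v v' h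
    have := g.injective (Subtype.ext h)
    simpa using this
  have h1 : ∑ j, ∑ v, ∑ u : Fin (k + l) → Bool,
      (if t ≤ (optimalGuess p f (g (j, v)) (f.enc (g (j, v)) u) : ℝ) then w / 2 ^ (k + l) else 0)
      ≤ guessTail p f t := by
    unfold guessTail
    rw [← Fintype.sum_prod_type' (f := fun j v => ∑ u : Fin (k + l) → Bool,
      (if t ≤ (optimalGuess p f (g (j, v)) (f.enc (g (j, v)) u) : ℝ) then w / 2 ^ (k + l) else 0))]
    calc _ ≤ ∑ q, ∑ u : Fin (k + l) → Bool, (if t ≤ (optimalGuess p f (g q) (f.enc (g q) u) : ℝ)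
          then p (g q) / 2 ^ (k + l) else 0) := by
          refine Finset.sum_le_sum fun q _ => Finset.sum_le_sum fun u _ => ?_
          have := hpw _ (g q).2
          split_ifs
          · gcongr
          · exact le_rfl
      _ = ∑ x ∈ Finset.univ.map (g.toEmbedding.trans (Function.Embedding.subtype T)),
          ∑ u : Fin (k + l) → Bool, (if t ≤ (optimalGuess p f x (f.enc x u) : ℝ)
          then p x / 2 ^ (k + l) else 0) := by
          rw [Finset.sum_map]
          rfl
      _ ≤ _ := by
          refine Finset.sum_le_univ_sum_of_nonneg fun x => Finset.sum_nonneg fun u _ => ?_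
          have := hp x
          split_ifs <;> positivity
  refine le_trans ?_ h1
  have h2 : ∀ j, w * (2 ^ k - t) ≤ ∑ v, ∑ u : Fin (k + l) → Bool,
      (if t ≤ (optimalGuess p f (g (j, v)) (f.enc (g (j, v)) u) : ℝ)
        then w / 2 ^ (k + l) else 0) := by
    intro j
    have h3 : ∀ v, ∑ u : Fin (k + l) → Bool,
        (if t ≤ (optimalGuess p f (g (j, v)) (f.enc (g (j, v)) u) : ℝ)
          then w / 2 ^ (k + l) else 0) =
        ∑ a, if t ≤ (optimalGuess p f (g (j, v)) (c (g (j, a))) : ℝ) then w / 2 ^ k else 0 := by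
      intro v
      have henc : ∀ u, f.enc (g (j, v)) u
          = c (g (j, xorPerm (fun i => u (Fin.castAdd l i)) v)) := blockCipher_enc c T g j v
      simp only [henc]
      -- The `l` idle key bits contribute a factor `2 ^ l`, and adding `v` permutes the remaining
      -- keys.
      rw [← (Fin.appendEquiv k l).sum_comp, Fintype.sum_prod_type,
        ← Equiv.sum_comp (xorPerm v) fun a =>
          if t ≤ (optimalGuess p f (g (j, v)) (c (g (j, a))) : ℝ) then w / 2 ^ k else 0]
      refine Finset.sum_congr rfl fun a _ => ?_
      simp only [Fin.appendEquiv, Equiv.coe_fn_mk, Fin.append_left]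
      rw [Finset.sum_const, nsmul_eq_mul, xorPerm_comm]
      simp only [Finset.card_univ, Fintype.card_fun, Fintype.card_bool, Fintype.card_fin]
      split_ifs
      · push_cast
        rw [pow_add]
        field_simp
      · simp
    simp only [h3]
    -- Now fix the cryptogram and count the messages of the block.
    rw [Finset.sum_comm]
    have h4 : ∀ a, w / 2 ^ k * (2 ^ k - t) ≤ ∑ v,
        if t ≤ (optimalGuess p f (g (j, v)) (c (g (j, a))) : ℝ) then w / 2 ^ k else 0 := by
      intro a
      rw [← Finset.sum_filter, Finset.sum_const, nsmul_eq_mul, mul_comm]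
      have := le_card_filter_guess p f (c (g (j, a))) ht (hinj j)
      simp only [Fintype.card_fun, Fintype.card_bool, Fintype.card_fin] at this
      push_cast at this
      gcongr
    refine le_trans (le_of_eq ?_) (Finset.sum_le_sum fun a _ => h4 a)
    rw [Finset.sum_const, nsmul_eq_mul]
    simp only [Finset.card_univ, Fintype.card_fun, Fintype.card_bool, Fintype.card_fin]
    push_cast
    field_simp
  refine le_trans (le_of_eq ?_) (Finset.sum_le_sum fun j _ => h2 j)
  rw [Finset.sum_const, nsmul_eq_mul, Finset.card_univ, Fintype.card_fin]
  ring

/-- If at most `k` key bits suffice to confuse an attacker who makes `t` guesses, then a set of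
messages that is large enough can be protected. -/
theorem exists_le_guessTail {k k' : ℕ} (hk : k' ≤ k) {p : M → ℝ} (hp : ∀ x, 0 ≤ p x)
    (T : Finset M) {w t : ℝ} (hw : 0 ≤ w) (ht : 0 ≤ t) (hpw : ∀ x ∈ T, w ≤ p x)
    (htk : 2 * t ≤ 2 ^ k') (hT : 2 ^ k' ≤ T.card) :
    ∃ f : Encryption M k, w * T.card / 4 ≤ guessTail p f t := by
  classical
  obtain ⟨l, rfl⟩ := Nat.exists_eq_add_of_le hk
  set m := T.card / 2 ^ k' with hm
  have hm1 : m * 2 ^ k' ≤ T.card := Nat.div_mul_le_self _ _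
  have hm0 : 1 ≤ m := (Nat.one_le_div_iff (by positivity)).2 hT
  have hm2 : T.card < 2 * (m * 2 ^ k') := by
    have h1 := Nat.lt_div_mul_add (a := T.card) (b := 2 ^ k') (by positivity)
    rw [← hm] at h1
    have h2 : 2 ^ k' ≤ m * 2 ^ k' := Nat.le_mul_of_pos_left _ hm0
    omega
  obtain ⟨T', hT', hcard⟩ := Finset.exists_subset_card_eq hm1
  have hequiv : Fintype.card (Fin m × (Fin k' → Bool)) = Fintype.card {x // x ∈ T'} := by
    simp [hcard]
  let g := Fintype.equivOfCardEq hequiv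
  let c : M ↪ List Bool := ⟨fun x => List.replicate (Fintype.equivFin M x) true, fun x y h =>
    (Fintype.equivFin M).injective (Fin.ext (by simpa using congrArg List.length h))⟩
  refine ⟨blockCipher c (· ∈ T') g, ?_⟩
  refine le_trans ?_ (le_guessTail_blockCipher c (· ∈ T') g hp hw ht
    fun x hx => hpw x (hT' hx))
  have h3 : (T.card : ℝ) ≤ 2 * (m * 2 ^ k') := by exact_mod_cast hm2.le
  have h4 : (T.card : ℝ) / 4 ≤ m * (2 ^ k' - t) := by
    have h5 : (2 : ℝ) ^ k' / 2 ≤ 2 ^ k' - t := by linarith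
    have h6 := mul_le_mul_of_nonneg_left h5 (Nat.cast_nonneg (α := ℝ) m)
    linarith
  calc w * T.card / 4 = w * (T.card / 4) := by ring
    _ ≤ w * (m * (2 ^ k' - t)) := by gcongr
    _ = _ := by ring

end Cipher

/-! ### Kraft's inequality and codeword lengths -/

section Coding

variable {M : Type*} [Fintype M]

theorem lengthTail_nonneg {p : M → ℝ} (hp : ∀ x, 0 ≤ p x) (L : M → ℕ) (t : ℝ) :
    0 ≤ lengthTail p L t := by
  refine Finset.sum_nonneg fun x _ => ?_
  split_ifs
  · exact hp x
  · exact le_rfl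

theorem two_inv_pow_eq_rpow (m : ℕ) : (2 : ℝ)⁻¹ ^ m = 2 ^ (-(m : ℝ)) := by
  rw [Real.rpow_neg two_pos.le, Real.rpow_natCast, inv_pow]

/-- Most members of a set that is large enough have long codewords. -/
theorem le_lengthTail {p : M → ℝ} (hp : ∀ x, 0 ≤ p x) {L : M → ℕ} (hL : IsLengthFunction L)
    (T : Finset M) {w t : ℝ} (hw : 0 ≤ w) (hpw : ∀ x ∈ T, w ≤ p x)
    (hT : 2 * 2 ^ t ≤ (T.card : ℝ)) : w * T.card / 4 ≤ lengthTail p L t := by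
  classical
  have h1 : ((T.filter fun x => ¬ t ≤ (L x : ℝ)).card : ℝ) ≤ 2 ^ t := by
    have h2 : ∀ x ∈ T.filter fun x => ¬ t ≤ (L x : ℝ), (2 : ℝ) ^ (-t) ≤ (2 : ℝ)⁻¹ ^ L x := by
      intro x hx
      have h3 := (Finset.mem_filter.1 hx).2
      rw [two_inv_pow_eq_rpow]
      gcongr
      · exact one_le_two
      · exact (not_le.1 h3).le
    have h4 := (Finset.card_nsmul_le_sum _ _ _ h2).trans
      ((Finset.sum_le_univ_sum_of_nonneg fun x => by positivity).trans hL)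
    rw [nsmul_eq_mul, Real.rpow_neg two_pos.le, ← div_eq_mul_inv,
      div_le_one (by positivity)] at h4
    exact h4
  have h2 : ((T.filter fun x => t ≤ (L x : ℝ)).card : ℝ)
      + (T.filter fun x => ¬ t ≤ (L x : ℝ)).card = T.card := by
    exact_mod_cast Finset.card_filter_add_card_filter_not (s := T) fun x => t ≤ (L x : ℝ)
  have h3 : ∑ x ∈ T.filter fun x => t ≤ (L x : ℝ), p x ≤ lengthTail p L t := by
    unfold lengthTail
    rw [← Finset.sum_filter]
    exact Finset.sum_le_sum_of_subset_of_nonneg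
      (Finset.filter_subset_filter _ (Finset.subset_univ T)) fun x _ _ => hp x
  have h4 := Finset.card_nsmul_le_sum (T.filter fun x => t ≤ (L x : ℝ)) p w
    fun x hx => hpw x (Finset.mem_filter.1 hx).1
  rw [nsmul_eq_mul] at h4
  have h5 : (T.card : ℝ) / 4 ≤ (T.filter fun x => t ≤ (L x : ℝ)).card := by
    have : (0 : ℝ) ≤ T.card := Nat.cast_nonneg _
    linarith
  have h6 := mul_le_mul_of_nonneg_left h5 hw
  linarith

/-- The members of a small set can be given short codewords. -/
theorem exists_lengthTail_le {p : M → ℝ} (hp : ∀ x, 0 ≤ p x) (A : Finset M) {a t : ℝ}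
    (hA : (A.card : ℝ) ≤ 2 ^ a) (hat : a + 2 ≤ t) :
    ∃ L, IsLengthFunction L ∧ lengthTail p L t ≤ ∑ x, p x - ∑ x ∈ A, p x := by
  classical
  let m := Fintype.card M
  have hm : (m : ℝ) ≤ 2 ^ m := by exact_mod_cast Nat.lt_two_pow_self.le
  -- The words for `A` and the words of length `m + 1` each use at most half of the Kraft sum.
  refine ⟨fun x => if x ∈ A then ⌈a⌉₊ + 1 else m + 1, ?_, ?_⟩
  · have h1 : ∀ x, (2 : ℝ)⁻¹ ^ (if x ∈ A then ⌈a⌉₊ + 1 else m + 1)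
        ≤ (if x ∈ A then (2 : ℝ) ^ (-a) / 2 else 0) + (2⁻¹) ^ (m + 1) := by
      intro x
      split_ifs
      · refine le_add_of_le_of_nonneg ?_ (by positivity)
        rw [pow_succ, two_inv_pow_eq_rpow, div_eq_mul_inv]
        gcongr
        · exact one_le_two
        · exact Nat.le_ceil a
      · simp
    refine (Finset.sum_le_sum fun x _ => h1 x).trans ?_
    rw [Finset.sum_add_distrib, ← Finset.sum_filter, Finset.sum_const, Finset.sum_const]
    simp only [Finset.filter_mem_eq_inter, Finset.univ_inter, nsmul_eq_mul, Finset.card_univ]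
    have h2 : (A.card : ℝ) * 2 ^ (-a) ≤ 1 := by
      rw [Real.rpow_neg two_pos.le, ← div_eq_mul_inv, div_le_one (by positivity)]
      exact hA
    have h3 : (m : ℝ) * 2⁻¹ ^ m ≤ 1 := by
      rw [inv_pow, ← div_eq_mul_inv, div_le_one (by positivity)]
      exact hm
    rw [pow_succ]
    change _ + (m : ℝ) * _ ≤ 1
    linarith
  · unfold lengthTail
    rw [le_sub_iff_add_le, ← Finset.sum_filter,
      ← Finset.sum_union]
    · exact Finset.sum_le_univ_sum_of_nonneg hp
    · rw [Finset.disjoint_left]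
      intro x hx hxA
      have h1 := (Finset.mem_filter.1 hx).2
      simp only [if_pos hxA] at h1
      have h2 : (1 : ℝ) ≤ A.card := by exact_mod_cast Finset.card_pos.2 ⟨x, hxA⟩
      -- For negative `a` the natural ceiling would be 0 and the length 1 might reach `t`; but then
      -- `A` would be empty.
      have h3 : 0 ≤ a := by
        by_contra! h
        linarith [Real.rpow_lt_one_of_one_lt_of_neg one_lt_two h]
      have h4 := Nat.ceil_lt_add_one h3
      push_cast at h1
      linarith

end Coding

/-! ### From probability bounds to limits of exponents -/

theorem le_negLogRate {n : ℕ} (hn : 0 < n) {q c : ℝ} (hq : 0 ≤ q) (h : q ≤ 2 ^ (-(n * c))) :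
    (c : EReal) ≤ negLogRate n q := by
  unfold negLogRate
  split_ifs with h0
  · exact le_top
  · rw [EReal.coe_le_coe_iff]
    have hq' : 0 < q := hq.lt_of_ne (Ne.symm h0)
    have h1 := (Real.logb_le_iff_le_rpow one_lt_two hq').2 h
    have hn' : (0 : ℝ) < n := by exact_mod_cast hn
    rw [neg_mul, one_div_mul_eq_div, ← neg_div, le_div_iff₀ hn']
    linarith

theorem negLogRate_le {n : ℕ} (hn : 0 < n) {q d : ℝ} (h : 2 ^ (-(n * d)) ≤ q) :
    negLogRate n q ≤ (d : EReal) := by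
  have hq : 0 < q := lt_of_lt_of_le (by positivity) h
  unfold negLogRate
  rw [if_neg hq.ne', EReal.coe_le_coe_iff]
  have h1 := (Real.le_logb_iff_rpow_le one_lt_two hq).2 h
  have hn' : (0 : ℝ) < n := by exact_mod_cast hn
  rw [neg_mul, one_div_mul_eq_div, ← neg_div, div_le_iff₀ hn']
  linarith

namespace UnifilarSource

variable {X S : Type*} [Fintype X] [Fintype S]

omit [Fintype S] in
theorem tendsto_guessExponent_top (P : UnifilarSource X S) {R B : ℝ} {k : ℕ → ℕ}
    (hk : Tendsto (fun n : ℕ => (k n : ℝ) / n) atTop (𝓝 R)) (h : R < B) :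
    Tendsto (fun n : ℕ => P.guessExponent n (k n) B) atTop (𝓝 ⊤) := by
  refine tendsto_const_nhds.congr' ?_
  filter_upwards [hk.eventually (eventually_lt_nhds h), eventually_gt_atTop 0] with n hn hn0
  have hn' : (0 : ℝ) < n := by exact_mod_cast hn0
  symm
  refine iInf_eq_top.2 fun f => ?_
  rw [negLogRate, if_pos]
  refine guessTail_eq_zero P.strProb_nonneg f ?_
  rw [← Real.rpow_natCast]
  refine Real.rpow_lt_rpow_of_exponent_lt one_lt_two ?_
  rw [div_lt_iff₀ hn'] at hn
  linarith

/-- No condition on the key length is needed, because the attack behind it ignores the cryptogram.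
-/
theorem eventually_lt_guessExponent (P : UnifilarSource X S) {B : ℝ} (k : ℕ → ℕ) {c : EReal}
    (h : c < P.errorExponent B) : ∀ᶠ n : ℕ in atTop, c < P.guessExponent n (k n) B := by
  obtain ⟨c', hc, hc'⟩ := EReal.lt_iff_exists_real_btwn.1 h
  obtain ⟨δ, hδ, hev⟩ := P.exists_small_set hc'
  filter_upwards [hev, eventually_gt_atTop 0] with n ⟨A, hA, hPA⟩ hn0
  have hn' : (0 : ℝ) < n := by exact_mod_cast hn0
  refine hc.trans_le (le_iInf fun f => ?_)
  refine le_negLogRate hn0 (guessTail_nonneg P.strProb_nonneg f _) ?_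
  refine (guessTail_le_sub P.strProb_nonneg f A (hA.trans_lt ?_)).trans hPA
  exact Real.rpow_lt_rpow_of_exponent_lt one_lt_two
    (mul_lt_mul_of_pos_left (by linarith) hn')

theorem eventually_lt_codeExponent (P : UnifilarSource X S) {B : ℝ} {c : EReal}
    (h : c < P.errorExponent B) : ∀ᶠ n : ℕ in atTop, c < P.codeExponent n B := by
  obtain ⟨c', hc, hc'⟩ := EReal.lt_iff_exists_real_btwn.1 h
  obtain ⟨δ, hδ, hev⟩ := P.exists_small_set hc'
  filter_upwards [hev, eventually_gt_atTop 0,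
    (tendsto_natCast_atTop_atTop.atTop_mul_const hδ).eventually_ge_atTop 2]
    with n ⟨A, hA, hPA⟩ hn0 hn2
  obtain ⟨L, hL, hLA⟩ := exists_lengthTail_le P.strProb_nonneg A hA (t := n * B) (by linarith)
  refine hc.trans_le (le_iSup_of_le ⟨L, hL⟩ ?_)
  exact le_negLogRate hn0 (lengthTail_nonneg P.strProb_nonneg L _) (hLA.trans hPA)

theorem Irreducible.eventually_guessExponent_lt {P : UnifilarSource X S} (hP : P.Irreducible)
    {R B : ℝ} {k : ℕ → ℕ} (hk : Tendsto (fun n : ℕ => (k n : ℝ) / n) atTop (𝓝 R)) (hBR : B < R)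
    (hB : ¬ IsGreatest P.attainableEntropies B) {d : EReal} (h : P.errorExponent B < d) :
    ∀ᶠ n : ℕ in atTop, P.guessExponent n (k n) B < d := by
  obtain ⟨d', hd', hd⟩ := EReal.lt_iff_exists_real_btwn.1 h
  obtain ⟨δ, hδ, hev⟩ := hP.exists_large_set hB hd'
  have hk' := hk.sub tendsto_one_div_atTop_nhds_zero_nat
  rw [sub_zero] at hk'
  filter_upwards [hev, eventually_gt_atTop 0, hk'.eventually (eventually_gt_nhds hBR),
    (tendsto_natCast_atTop_atTop.atTop_mul_const hδ).eventually_ge_atTop 2]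
    with n ⟨T, w, hw, hT, hpw, hle⟩ hn0 hkn hn2
  have hn' : (0 : ℝ) < n := by exact_mod_cast hn0
  rw [← sub_div, lt_div_iff₀ hn'] at hkn
  -- This number of pad bits makes a block at least twice the guess threshold; the slack `n δ ≥ 2`
  -- covers the 1 and the rounding, so a block fits into `T`.
  have hkk : ⌈n * B + 1⌉₊ ≤ k n := Nat.ceil_le.2 (by linarith)
  have htk : 2 * (2 : ℝ) ^ (n * B) ≤ 2 ^ ⌈n * B + 1⌉₊ := by
    rw [← Real.rpow_natCast, mul_comm, ← Real.rpow_add_one two_pos.ne']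
    gcongr
    · exact one_le_two
    · exact Nat.le_ceil _
  have hTk : 2 ^ ⌈n * B + 1⌉₊ ≤ T.card := by
    rcases le_or_gt (n * B + 1) 0 with h0 | h0
    · rw [Nat.ceil_eq_zero.2 h0, pow_zero]
      have : (0 : ℝ) < T.card := lt_of_lt_of_le (by positivity) hT
      exact_mod_cast this
    · have h1 : (2 : ℝ) ^ ⌈n * B + 1⌉₊ ≤ T.card := by
        refine le_trans ?_ hT
        rw [← Real.rpow_natCast]
        have := Nat.ceil_lt_add_one h0.le
        gcongr
        · exact one_le_two
        · linarith
      exact_mod_cast h1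
  obtain ⟨f, hf⟩ := exists_le_guessTail hkk P.strProb_nonneg T hw (by positivity) hpw htk hTk
  exact ((iInf_le _ f).trans (negLogRate_le hn0 (hle.trans hf))).trans_lt hd

theorem Irreducible.eventually_codeExponent_lt {P : UnifilarSource X S} (hP : P.Irreducible)
    {B : ℝ} (hB : ¬ IsGreatest P.attainableEntropies B) {d : EReal} (h : P.errorExponent B < d) :
    ∀ᶠ n : ℕ in atTop, P.codeExponent n B < d := by
  obtain ⟨d', hd', hd⟩ := EReal.lt_iff_exists_real_btwn.1 h
  obtain ⟨δ, hδ, hev⟩ := hP.exists_large_set hB hd'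
  filter_upwards [hev, eventually_gt_atTop 0,
    (tendsto_natCast_atTop_atTop.atTop_mul_const hδ).eventually_ge_atTop 1]
    with n ⟨T, w, hw, hT, hpw, hle⟩ hn0 hn1
  refine lt_of_le_of_lt (iSup_le fun L => ?_) hd
  refine negLogRate_le hn0 (hle.trans (le_lengthTail P.strProb_nonneg L.2 T hw hpw ?_))
  refine le_trans ?_ hT
  rw [mul_comm, ← Real.rpow_add_one two_pos.ne']
  gcongr
  · exact one_le_two
  · linarith

/-! ### Attainment of the minimum -/

/-- Give every letter probability `1 / |X|`: the cross-entropy is then constantly `log |X|`, and a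
stationary law of zero divergence has that entropy. -/
theorem exists_stationary_logb_card_le_condEntropy (P : UnifilarSource X S) :
    ∃ Q, P.IsStationaryPMF Q ∧ Real.logb 2 (Fintype.card X) ≤ condEntropy Q := by
  have hX : (Fintype.card X : ℝ) ≠ 0 := by
    intro h
    have h1 : IsEmpty X := Fintype.card_eq_zero_iff.1 (by exact_mod_cast h)
    simpa using P.prob_sum P.init
  let U : UnifilarSource X S :=
    { P with
      prob := fun _ _ => (Fintype.card X : ℝ)⁻¹
      prob_nonneg := fun _ _ => by positivity
      prob_sum := fun _ => by simp [hX] }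
  obtain ⟨Q, hQ, -, hdiv⟩ := U.exists_stationary
  refine ⟨Q, ⟨hQ.nonneg, hQ.sum_eq_one, hQ.stationary⟩, ?_⟩
  have h1 : U.meanLog Q = -Real.logb 2 (Fintype.card X) := by
    simp only [meanLog, U, Real.logb_inv, ← Finset.sum_mul, hQ.sum_eq_one, one_mul]
  unfold realDiv at hdiv
  linarith

theorem isCompact_feasible (P : UnifilarSource X S) (B : ℝ) :
    IsCompact {Q | P.IsStationaryPMF Q ∧ P.AbsCont Q ∧ B ≤ condEntropy Q} := by
  have h1 : IsClosed (jointPMFs S X ∩ condEntropy ⁻¹' Set.Ici B) :=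
    (continuousOn_condEntropy.mono fun Q hQ => hQ.1).preimage_isClosed_of_isClosed
      isCompact_jointPMFs.isClosed isClosed_Ici
  have h2 : IsClosed {Q | ∀ t, P.netFlow Q t = 0} := by
    simp only [Set.ofPred_forall]
    exact isClosed_iInter fun t => isClosed_eq (P.continuous_netFlow t) continuous_const
  have h3 : IsClosed {Q | P.AbsCont Q} := by
    simp only [AbsCont, Set.ofPred_forall]
    exact isClosed_iInter fun s => isClosed_iInter fun x => isClosed_iInter fun _ =>
      isClosed_eq (by fun_prop) continuous_const
  refine isCompact_jointPMFs.of_isClosed_subset ?_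
    fun Q hQ => ((P.isStationaryPMF_iff Q).1 hQ.1).1
  convert (h1.inter h2).inter h3 using 1
  ext Q
  simp only [Set.mem_ofPred_eq, P.isStationaryPMF_iff, Set.mem_inter_iff, Set.mem_preimage,
    Set.mem_Ici]
  tauto

/-- Finite divergences form a continuous function on a compact set. If none is feasible, the value
`∞` is still attained, and this needs a feasible law: hence the bound on `B`. -/
theorem isLeast_errorExponent (P : UnifilarSource X S) {B : ℝ}
    (hB : B ≤ Real.logb 2 (Fintype.card X)) :
    IsLeast (P.feasibleDivs B) (P.errorExponent B) := by
  suffices h : ∃ d, IsLeast (P.feasibleDivs B) d by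
    obtain ⟨d, hd⟩ := h
    rwa [errorExponent, hd.isGLB.sInf_eq]
  by_cases hne : {Q | P.IsStationaryPMF Q ∧ P.AbsCont Q ∧ B ≤ condEntropy Q}.Nonempty
  · obtain ⟨Q, ⟨hQ, hac, hBQ⟩, hmin⟩ := (P.isCompact_feasible B).exists_isMinOn hne
      (P.continuousOn_realDiv.mono fun Q hQ => hQ.1.nonneg)
    refine ⟨P.condDiv Q, ⟨Q, hQ, hBQ, rfl⟩, ?_⟩
    rintro _ ⟨Q', hQ', hBQ', rfl⟩
    by_cases hac' : P.AbsCont Q'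
    · rw [P.condDiv_of_absCont hQ.nonneg hac, P.condDiv_of_absCont hQ'.nonneg hac',
        EReal.coe_le_coe_iff]
      exact hmin ⟨hQ', hac', hBQ'⟩
    · rw [condDiv, condDiv, if_neg hac']
      exact le_top
  · obtain ⟨Q, hQ, hBQ⟩ := P.exists_stationary_logb_card_le_condEntropy
    refine ⟨P.condDiv Q, ⟨Q, hQ, hB.trans hBQ, rfl⟩, ?_⟩
    rintro _ ⟨Q', hQ', hBQ', rfl⟩
    rw [condDiv, condDiv, if_neg fun hac' => hne ⟨Q', hQ', hac', hBQ'⟩]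
    exact le_top

end UnifilarSource

end

theorem mainTheorem7 {X S : Type*} [Fintype X] [Fintype S] (P : UnifilarSource X S)
    (R B : ℝ) (k : ℕ → ℕ) (hk : Tendsto (fun n : ℕ => (k n : ℝ) / n) atTop (𝓝 R)) :
    (R < B → Tendsto (fun n : ℕ => P.guessExponent n (k n) B) atTop (𝓝 ⊤)) ∧
    (P.Irreducible → ¬ IsGreatest P.attainableEntropies B →
      (B < R →
        Tendsto (fun n : ℕ => P.guessExponent n (k n) B) atTop (𝓝 (P.errorExponent B))) ∧
      Tendsto (fun n : ℕ => P.codeExponent n B) atTop (𝓝 (P.errorExponent B))) ∧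
    (B ≤ Real.logb 2 (Fintype.card X) → IsLeast (P.feasibleDivs B) (P.errorExponent B)) := by
  refine ⟨P.tendsto_guessExponent_top hk, fun hP hB => ⟨fun hBR => ?_, ?_⟩,
    P.isLeast_errorExponent⟩
  · exact tendsto_order.2 ⟨fun _ h => P.eventually_lt_guessExponent k h,
      fun _ h => hP.eventually_guessExponent_lt hk hBR hB h⟩
  · exact tendsto_order.2 ⟨fun _ h => P.eventually_lt_codeExponent h,
      fun _ h => hP.eventually_codeExponent_lt hB h⟩
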